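/- All manifolds, bundles, maps and sections are smooth; manifolds are Hausdorff, second countable and connected. Let $M$ be an oriented four-manifold and $g$ a Lorentzian metric on $M$ of signature $(3,1)$. Let $\mathcal{D}=(\Sigma,\Xi)$ be a scalar-electromagnetic structure, that is: - $\Sigma=(\mathcal{M},\mathcal{G},\Phi)$, where $(\mathcal{M},\mathcal{G})$ is a Riemannian manifold and $\Phi\in\mathcal{C}^\infty(\mathcal{M},\mathbb{R})$; - $\Xi=(\mathcal{S},D,J,\omega)$, where $\mathcal{S}$ is a real vector bundle of finite rank over $\mathcal{M}$, $\omega$ is a symplectic pairing on $\mathcal{S}$, $D$ is a flat connection on $\mathcal{S}$ for which $\omega$ is parallel, and $J$ is a taming of $(\mathcal{S},\omega)$: an endomorphism of $\mathcal{S}$ with $J^2=-1$, $\omega(J\cdot,J\cdot)=\omega$ and $Q:=\omega(J\cdot,\cdot)$ positive definite. Let $\Theta=D\circ J-J\circ D\in\Omega^1(\mathcal{M},\mathrm{End}(\mathcal{S}))$ and $\Psi=(\sharp_{\mathcal{G}}\otimes\mathrm{id})(\Theta)\in\Gamma(\mathcal{M},T\mathcal{M}\otimes \mathrm{End}(\mathcal{S}))$.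 The superscript $\varphi$ denotes pullback along a map $\varphi:M\to\mathcal{M}$. The set $\mathrm{Conf}^g_{\mathcal{D}}(M)$ of global configurations consists of the pairs $(\varphi,\mathcal{V})$ with $\varphi\in\mathcal{C}^\infty(M,\mathcal{M})$ and $\mathcal{V}\in\Omega^2(M,\mathcal{S}^\varphi)$ which is positively polarized, i.e. $(\ast_g\otimes J^\varphi)\mathcal{V}=\mathcal{V}$, where $\ast_g$ is the Hodge operator. The set $\mathrm{Sol}^g_{\mathcal{D}}(M)$ of global scalar-electromagnetic solutions consists of those $(\varphi,\mathcal{V})\in \mathrm{Conf}^g_{\mathcal{D}}(M)$ which satisfy $$\mathrm{Tr}_g\nabla \mathrm{d}\varphi-(\mathrm{grad}_{\mathcal{G}}\Phi)^\varphi-\tfrac12\,(\ast_g\mathcal{V},\Psi^\varphi\mathcal{V})=0 \quad\text{(scalar equation)},\qquad \mathrm{d}_{D^\varphi}\mathcal{V}=0\quad\text{(twisted electromagnetic equation)}.$$ Here $\nabla$ is induced by the Levi-Civita connections of $g$ and $\mathcal{G}$, the pairing $(\cdot,\cdot)$ is induced by $g$ and $Q^\varphi$ and extended trivially to a $(T\mathcal{M})^\varphi$-valued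 pairing, and $\mathrm{d}_{D^\varphi}$ is the de Rham differential twisted by $D^\varphi$. An unbased automorphism of $\mathcal{S}$ is a diffeomorphism $f$ of the total space of $\mathcal{S}$ which maps fibers linearly and isomorphically onto fibers and covers a diffeomorphism $f_0$ of $\mathcal{M}$; let $\hat f:\mathcal{S}\to\mathcal{S}^{f_0}$ be the induced based isomorphism. Let $\mathrm{Aut}(\mathcal{D})$ be the group of unbased automorphisms $f$ of $\mathcal{S}$ which preserve $\omega$, are covariantly constant with respect to $D$ (i.e. commute with $D$), satisfy $\mathbf{Ad}(f)(J):=f\circ J\circ f^{-1}=J$, and for which $f_0$ is an isometry of $(\mathcal{M},\mathcal{G})$ with $\Phi\circ f_0=\Phi$. Define the duality action by $f\diamond(\varphi,\mathcal{V})=(f_0\circ\varphi,\hat f^\varphi(\mathcal{V}))$. **Claim.** For every $f\in\mathrm{Aut}(\mathcal{D})$, $$f\diamond \mathrm{Sol}^g_{\mathcal{D}}(M)=\mathrm{Sol}^g_{\mathcal{D}}(M).$$ Thus $\mathrm{Aut}(\mathcal{D})$ acts by symmetries of the scalar and twisted electromagnetic equations for every fixed Lorentzian metric $g$: for every $(\varphi,\mathcal{V})\in\mathrm{Conf}^g_{\mathcal{D}}(M)$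 the pair $f\diamond(\varphi,\mathcal{V})$ lies in $\mathrm{Conf}^g_{\mathcal{D}}(M)$, and it is a solution if and only if $(\varphi,\mathcal{V})$ is. -/

import Mathlib

open Bundle Module FiberBundle
open scoped Manifold ContDiff Topology TensorProduct

set_option linter.unusedSectionVars false

noncomputable section

namespace ESM

/-! ### Pseudo-Riemannian metrics and the Levi-Civita connection -/

section Metrics

variable {E : Type*} [NormedAddCommGroup E] [NormedSpace ℝ E]
  {N : Type*} [TopologicalSpace N] [ChartedSpace E N]

instance [FiniteDimensional ℝ E] (x : N) : FiniteDimensional ℝ (TangentSpace 𝓘(ℝ, E) x) :=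
  inferInstanceAs (FiniteDimensional ℝ E)

instance (x : N) : T2Space (TangentSpace 𝓘(ℝ, E) x) := inferInstanceAs (T2Space E)

variable (E N) in
/-- A smooth pseudo-Riemannian metric on a manifold without boundary modelled on `E`. -/
structure PseudoRiemannianMetric [IsManifold 𝓘(ℝ, E) ∞ N] where
  /-- the scalar product on each tangent space -/
  val (x : N) : TangentSpace 𝓘(ℝ, E) x →L[ℝ] TangentSpace 𝓘(ℝ, E) x →L[ℝ] ℝ
  symm (x : N) (v w : TangentSpace 𝓘(ℝ, E) x) : val x v w = val x w v
  nondegenerate (x : N) (v : TangentSpace 𝓘(ℝ, E) x) (hv : ∀ w, val x v w = 0) : v = 0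
  contMDiff : ContMDiff 𝓘(ℝ, E) (𝓘(ℝ, E).prod 𝓘(ℝ, E →L[ℝ] E →L[ℝ] ℝ)) ∞
    (fun x ↦ TotalSpace.mk' (E →L[ℝ] E →L[ℝ] ℝ)
      (E := fun x : N ↦ TangentSpace 𝓘(ℝ, E) x →L[ℝ] TangentSpace 𝓘(ℝ, E) x →L[ℝ] ℝ) x (val x))

variable [IsManifold 𝓘(ℝ, E) ∞ N]

/-- A Riemannian metric, seen as a pseudo-Riemannian metric. -/
def PseudoRiemannianMetric.ofRiemannian
    (G : ContMDiffRiemannianMetric 𝓘(ℝ, E) ∞ E (TangentSpace 𝓘(ℝ, E) : N → Type _)) :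
    PseudoRiemannianMetric E N where
  val := G.inner
  symm := G.symm
  nondegenerate x v hv := by
    by_contra h
    exact (G.pos x v h).ne' (hv v)
  contMDiff := G.contMDiff

namespace PseudoRiemannianMetric

variable (h : PseudoRiemannianMetric E N)

/-- The metric at a point, as an algebraic bilinear form. -/
def bilin (x : N) : LinearMap.BilinForm ℝ (TangentSpace 𝓘(ℝ, E) x) :=
  (ContinuousLinearMap.coeLM ℝ).comp (h.val x).toLinearMap

@[simp] lemma bilin_apply (x : N) (v w : TangentSpace 𝓘(ℝ, E) x) :
    h.bilin x v w = h.val x v w := rfl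

lemma bilin_nondegenerate (x : N) : (h.bilin x).Nondegenerate :=
  ⟨fun v hv ↦ h.nondegenerate x v hv,
    fun v hv ↦ h.nondegenerate x v fun w ↦ (h.symm x v w).trans (hv w)⟩

/-- The musical isomorphism `♯ : T*N → TN`, characterised by `h (♯ α) w = α w`. -/
def sharp [FiniteDimensional ℝ E] (x : N) :
    Dual ℝ (TangentSpace 𝓘(ℝ, E) x) ≃ₗ[ℝ] TangentSpace 𝓘(ℝ, E) x :=
  ((h.bilin x).toDual (h.bilin_nondegenerate x)).symm

@[simp] lemma val_sharp [FiniteDimensional ℝ E] (x : N)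
    (α : Dual ℝ (TangentSpace 𝓘(ℝ, E) x)) (w : TangentSpace 𝓘(ℝ, E) x) :
    h.val x (h.sharp x α) w = α w :=
  LinearMap.BilinForm.apply_toDual_symm_apply (hB := h.bilin_nondegenerate x) α w

/-- The function `h(X, Y)`. -/
def pair (X Y : Π x : N, TangentSpace 𝓘(ℝ, E) x) (x : N) : ℝ := h.val x (X x) (Y x)

/-- The right-hand side of the Koszul formula for `2 h(∇_X Y, Z)`. -/
def koszul (X Y Z : Π x : N, TangentSpace 𝓘(ℝ, E) x) (x : N) : ℝ :=
  (d% (h.pair Y Z)) x (X x) + (d% (h.pair X Z)) x (Y x) - (d% (h.pair X Y)) x (Z x)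
    + h.val x (VectorField.mlieBracket 𝓘(ℝ, E) X Y x) (Z x)
    - h.val x (VectorField.mlieBracket 𝓘(ℝ, E) X Z x) (Y x)
    - h.val x (VectorField.mlieBracket 𝓘(ℝ, E) Y Z x) (X x)

variable {h} {X X' Y Z : Π x : N, TangentSpace 𝓘(ℝ, E) x} {x : N}

lemma mdifferentiableAt_pair (hX : MDiffAt (T% X) x) (hY : MDiffAt (T% Y) x) :
    MDiffAt (h.pair X Y) x := by
  have h1 : MDifferentiableAt 𝓘(ℝ, E) (𝓘(ℝ, E).prod 𝓘(ℝ, ℝ))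
      (fun y ↦ TotalSpace.mk' ℝ (E := Bundle.Trivial N ℝ) y (h.val y (X y) (Y y))) x := by
    apply MDifferentiableAt.clm_bundle_apply₂ (F₁ := E) (F₂ := E)
    · exact h.contMDiff.mdifferentiableAt (by simp)
    · exact hX
    · exact hY
  simp only [mdifferentiableAt_totalSpace] at h1
  exact h1.2

lemma pair_comm (X Y : Π x : N, TangentSpace 𝓘(ℝ, E) x) : h.pair X Y = h.pair Y X :=
  funext fun y ↦ h.symm y _ _

lemma pair_add_left (X X' Y : Π x : N, TangentSpace 𝓘(ℝ, E) x) :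
    h.pair (X + X') Y = h.pair X Y + h.pair X' Y := by
  ext y; simp [pair]

lemma pair_add_right (X Y Y' : Π x : N, TangentSpace 𝓘(ℝ, E) x) :
    h.pair X (Y + Y') = h.pair X Y + h.pair X Y' := by
  ext y; simp [pair]

lemma pair_smul_left (f : N → ℝ) (X Y : Π x : N, TangentSpace 𝓘(ℝ, E) x) :
    h.pair (f • X) Y = f * h.pair X Y := by
  ext y; simp [pair]

lemma pair_smul_right (f : N → ℝ) (X Y : Π x : N, TangentSpace 𝓘(ℝ, E) x) :
    h.pair X (f • Y) = f * h.pair X Y := by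
  ext y; simp [pair]

variable [FiniteDimensional ℝ E]

lemma tensorialAt_koszul_left (hY : MDiffAt (T% Y) x) (hZ : MDiffAt (T% Z) x) :
    TensorialAt 𝓘(ℝ, E) E (fun X ↦ h.koszul X Y Z x) x where
  smul {f X} hf hX := by
    have e1 := mdifferentiableAt_pair (h := h) hX hY
    have e2 := mdifferentiableAt_pair (h := h) hX hZ
    simp [koszul, pair_smul_left, mvfderiv_mul hf e1, mvfderiv_mul hf e2,
      VectorField.mlieBracket_smul_left hf hX]
    simp only [pair]
    ring
  add {X X'} hX hX' := by
    have e1 := mdifferentiableAt_pair (h := h) hX hY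
    have e2 := mdifferentiableAt_pair (h := h) hX hZ
    have e1' := mdifferentiableAt_pair (h := h) hX' hY
    have e2' := mdifferentiableAt_pair (h := h) hX' hZ
    simp [koszul, pair_add_left, mvfderiv_add e1 e1', mvfderiv_add e2 e2',
      VectorField.mlieBracket_add_left hX hX']
    ring

lemma tensorialAt_koszul_right (hX : MDiffAt (T% X) x) (hY : MDiffAt (T% Y) x) :
    TensorialAt 𝓘(ℝ, E) E (fun Z ↦ h.koszul X Y Z x) x where
  smul {f Z} hf hZ := by
    have e1 := mdifferentiableAt_pair (h := h) hY hZ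
    have e2 := mdifferentiableAt_pair (h := h) hX hZ
    simp [koszul, pair_smul_right, mvfderiv_mul hf e1, mvfderiv_mul hf e2,
      VectorField.mlieBracket_smul_right hf hZ, h.symm x (Z x)]
    simp only [pair]
    ring
  add {Z Z'} hZ hZ' := by
    have e1 := mdifferentiableAt_pair (h := h) hY hZ
    have e2 := mdifferentiableAt_pair (h := h) hX hZ
    have e1' := mdifferentiableAt_pair (h := h) hY hZ'
    have e2' := mdifferentiableAt_pair (h := h) hX hZ'
    simp [koszul, pair_add_right, mvfderiv_add e1 e1', mvfderiv_add e2 e2',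
      VectorField.mlieBracket_add_right hZ hZ']
    ring

variable (h) in
/-- The Koszul form at `x`, as a bilinear map of the two vectors `X x` and `Z x`. -/
def koszulForm (Y : Π x : N, TangentSpace 𝓘(ℝ, E) x) (x : N) (hY : MDiffAt (T% Y) x) :
    TangentSpace 𝓘(ℝ, E) x →L[ℝ] TangentSpace 𝓘(ℝ, E) x →L[ℝ] ℝ :=
  TensorialAt.mkHom₂ (I := 𝓘(ℝ, E)) (F := E) (F' := E) (fun X Z ↦ h.koszul X Y Z x) x
    (fun _ hZ ↦ tensorialAt_koszul_left hY hZ) (fun _ hX ↦ tensorialAt_koszul_right hX hY)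

lemma koszulForm_apply (hX : MDiffAt (T% X) x) (hY : MDiffAt (T% Y) x) (hZ : MDiffAt (T% Z) x) :
    h.koszulForm Y x hY (X x) (Z x) = h.koszul X Y Z x :=
  TensorialAt.mkHom₂_apply (I := 𝓘(ℝ, E)) (F := E) (F' := E) _ _ hX hZ

open Classical in
variable (h) in
/-- `v ↦ ∇_v Y`, where `∇` is the Levi-Civita connection of `h`, determined by the Koszul
formula. -/
def leviCivitaAux (Y : Π x : N, TangentSpace 𝓘(ℝ, E) x) (x : N) :
    TangentSpace 𝓘(ℝ, E) x →L[ℝ] TangentSpace 𝓘(ℝ, E) x :=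
  if hY : MDiffAt (T% Y) x then
    LinearMap.toContinuousLinearMap <| (1 / 2 : ℝ) •
      ((h.sharp x).toLinearMap ∘ₗ (ContinuousLinearMap.coeLM ℝ).comp
        (h.koszulForm Y x hY).toLinearMap)
  else 0

lemma val_leviCivitaAux (hX : MDiffAt (T% X) x) (hY : MDiffAt (T% Y) x) (hZ : MDiffAt (T% Z) x) :
    2 * h.val x (h.leviCivitaAux Y x (X x)) (Z x) = h.koszul X Y Z x := by
  rw [← koszulForm_apply hX hY hZ, leviCivitaAux, dif_pos hY]
  simp

lemma leviCivitaAux_eq_of_koszul (hY : MDiffAt (T% Y) x)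
    (A : TangentSpace 𝓘(ℝ, E) x →L[ℝ] TangentSpace 𝓘(ℝ, E) x)
    (H : ∀ X Z : Π x : N, TangentSpace 𝓘(ℝ, E) x, MDiffAt (T% X) x → MDiffAt (T% Z) x →
      2 * h.val x (A (X x)) (Z x) = h.koszul X Y Z x) :
    h.leviCivitaAux Y x = A := by
  ext1 v
  refine sub_eq_zero.1 (h.nondegenerate x _ fun w ↦ ?_)
  have hv := mdifferentiableAt_extend 𝓘(ℝ, E) E (x := x) v
  have hw := mdifferentiableAt_extend 𝓘(ℝ, E) E (x := x) w
  have e1 := val_leviCivitaAux (h := h) hv hY hw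
  have e2 := H _ _ hv hw
  simp only [extend_apply_self] at e1 e2
  rw [map_sub, sub_apply]
  linarith

variable (h) in
/-- The Levi-Civita connection of a pseudo-Riemannian metric. -/
def leviCivita : CovariantDerivative 𝓘(ℝ, E) E (TangentSpace 𝓘(ℝ, E) : N → Type _) where
  toFun := h.leviCivitaAux
  isCovariantDerivativeOnUniv :=
    { add := by
        intro Y Y' x hY hY' _
        refine leviCivitaAux_eq_of_koszul (mdifferentiableAt_add_section hY hY') _ ?_
        intro X Z hX hZ
        have e1 := val_leviCivitaAux (h := h) hX hY hZ
        have e2 := val_leviCivitaAux (h := h) hX hY' hZ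
        rw [add_apply, map_add, add_apply, mul_add, e1, e2]
        have e1 := mdifferentiableAt_pair (h := h) hY hZ
        have e2 := mdifferentiableAt_pair (h := h) hX hY
        have e1' := mdifferentiableAt_pair (h := h) hY' hZ
        have e2' := mdifferentiableAt_pair (h := h) hX hY'
        simp [koszul, pair_add_right, pair_add_left, mvfderiv_add e1 e1', mvfderiv_add e2 e2',
          VectorField.mlieBracket_add_right hY hY', VectorField.mlieBracket_add_left hY hY']
        ring
      leibniz := by
        intro Y f x hY hf _
        refine leviCivitaAux_eq_of_koszul (hf.smul_section hY) _ ?_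
        intro X Z hX hZ
        have e0 := val_leviCivitaAux (h := h) hX hY hZ
        have e1 := mdifferentiableAt_pair (h := h) hY hZ
        have e2 := mdifferentiableAt_pair (h := h) hX hY
        simp [koszul, pair_smul_left, pair_smul_right, mvfderiv_mul hf e1, mvfderiv_mul hf e2,
          VectorField.mlieBracket_smul_right hf hY, VectorField.mlieBracket_smul_left hf hY,
          h.symm x (Y x) (X x)] at e0 ⊢
        simp only [pair] at e0 ⊢
        linear_combination f x * e0 }

lemma torsion_leviCivita : h.leviCivita.torsion = 0 := by
  rw [CovariantDerivative.torsion_eq_zero_iff]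
  intro X Y x hX hY
  refine sub_eq_zero.1 (h.nondegenerate x _ fun w ↦ ?_)
  have hw := mdifferentiableAt_extend 𝓘(ℝ, E) E (x := x) w
  have e1 := val_leviCivitaAux (h := h) hX hY hw
  have e2 := val_leviCivitaAux (h := h) hY hX hw
  simp [koszul, pair_comm Y X, VectorField.mlieBracket_swap_apply (V := Y) (W := X)] at e1 e2
  simp [leviCivita]
  linarith

lemma mvfderiv_pair (hX : MDiffAt (T% X) x) (hY : MDiffAt (T% Y) x) (hZ : MDiffAt (T% Z) x) :
    (d% (h.pair Y Z)) x (X x) =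
      h.val x (h.leviCivita Y x (X x)) (Z x) + h.val x (Y x) (h.leviCivita Z x (X x)) := by
  have e1 := val_leviCivitaAux (h := h) hX hY hZ
  have e2 := val_leviCivitaAux (h := h) hX hZ hY
  simp [koszul, pair_comm Z Y, VectorField.mlieBracket_swap_apply (V := Z) (W := Y)] at e1 e2
  rw [h.symm x (Y x)]
  simp [leviCivita]
  linarith

end PseudoRiemannianMetric
end Metrics

/-! ### Connections and pulled-back connections -/

section Connections

variable {E : Type*} [NormedAddCommGroup E] [NormedSpace ℝ E]
  {N : Type*} [TopologicalSpace N] [ChartedSpace E N] [IsManifold 𝓘(ℝ, E) ∞ N]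
  (F : Type*) [NormedAddCommGroup F] [NormedSpace ℝ F]
  {S : N → Type*} [TopologicalSpace (TotalSpace F S)]
  [∀ y, AddCommGroup (S y)] [∀ y, Module ℝ (S y)] [∀ y, TopologicalSpace (S y)]
  [∀ y, IsTopologicalAddGroup (S y)] [∀ y, ContinuousSMul ℝ (S y)]
  [FiberBundle F S]
  {E' : Type*} [NormedAddCommGroup E'] [NormedSpace ℝ E']
  {M : Type*} [TopologicalSpace M] [ChartedSpace E' M]

/-- The pulled-back connection `D^φ` on `S^φ`, applied to a section `s` of `S^φ`. In the
preferred trivialization of `S` at `φ x`, with connection form `A`, this is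
`D^φ_u s = d s (u) + A (dφ u) s`: the second summand is the covariant derivative along `dφ u` of
the section of `S` which is constant in that trivialization and takes the value `s x` at `φ x`. -/
def pullbackConnection (D : CovariantDerivative 𝓘(ℝ, E) F S) (φ : M → N)
    (s : Π x : M, S (φ x)) (x : M) (u : TangentSpace 𝓘(ℝ, E') x) : S (φ x) :=
  (trivializationAt F S (φ x)).symm (φ x)
      ((d% (fun x' : M ↦ (trivializationAt F S (φ x) ⟨φ x', s x'⟩).2)) x u)
    + D (extend F (s x)) (φ x) (mfderiv 𝓘(ℝ, E') 𝓘(ℝ, E) φ x u)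

/-- The value at `x` of `d_{D^φ} V` on vector fields `X, Y, Z`, for an `S^φ`-valued two-form `V`. -/
def twistedExtDeriv (D : CovariantDerivative 𝓘(ℝ, E) F S) (φ : M → N)
    (V : Π x : M, TangentSpace 𝓘(ℝ, E') x [⋀^Fin 2]→ₗ[ℝ] S (φ x))
    (X Y Z : Π x : M, TangentSpace 𝓘(ℝ, E') x) (x : M) : S (φ x) :=
  pullbackConnection F D φ (fun x' ↦ V x' ![Y x', Z x']) x (X x)
    - pullbackConnection F D φ (fun x' ↦ V x' ![X x', Z x']) x (Y x)
    + pullbackConnection F D φ (fun x' ↦ V x' ![X x', Y x']) x (Z x)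
    - V x ![VectorField.mlieBracket 𝓘(ℝ, E') X Y x, Z x]
    + V x ![VectorField.mlieBracket 𝓘(ℝ, E') X Z x, Y x]
    - V x ![VectorField.mlieBracket 𝓘(ℝ, E') Y Z x, X x]

/-- The connection `D` is flat: `D_X D_Y σ - D_Y D_X σ - D_{[X,Y]} σ = 0`. -/
def IsFlat (D : CovariantDerivative 𝓘(ℝ, E) F S) : Prop :=
  ∀ (X Y : Π y : N, TangentSpace 𝓘(ℝ, E) y) (σ : Π y : N, S y),
    CMDiff ∞ (T% X) → CMDiff ∞ (T% Y) → CMDiff ∞ (T% σ) → ∀ y : N,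
      D (fun z ↦ D σ z (Y z)) y (X y) - D (fun z ↦ D σ z (X z)) y (Y y)
        - D σ y (VectorField.mlieBracket 𝓘(ℝ, E) X Y y) = 0

end Connections

/-! ### Duality structures and electromagnetic structures -/

section Structures

variable {E : Type*} [NormedAddCommGroup E] [NormedSpace ℝ E]
  {N : Type*} [TopologicalSpace N] [ChartedSpace E N] [IsManifold 𝓘(ℝ, E) ∞ N]
  {F : Type*} [NormedAddCommGroup F] [NormedSpace ℝ F]
  {S : N → Type*} [TopologicalSpace (TotalSpace F S)]
  [∀ y, AddCommGroup (S y)] [∀ y, Module ℝ (S y)] [∀ y, TopologicalSpace (S y)]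
  [∀ y, IsTopologicalAddGroup (S y)] [∀ y, ContinuousSMul ℝ (S y)]
  [FiberBundle F S] [VectorBundle ℝ F S] [ContMDiffVectorBundle ∞ F S 𝓘(ℝ, E)]

variable (E N) in
/-- A scalar structure `(N, G, Φ)`: a Riemannian metric and a smooth potential on `N`. -/
structure ScalarStructure where
  /-- the Riemannian metric -/
  G : ContMDiffRiemannianMetric 𝓘(ℝ, E) ∞ E (TangentSpace 𝓘(ℝ, E) : N → Type _)
  /-- the scalar potential -/
  Φ : N → ℝ
  contMDiff_Φ : ContMDiff 𝓘(ℝ, E) 𝓘(ℝ, ℝ) ∞ Φ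

/-- The scalar metric as a pseudo-Riemannian metric. -/
def ScalarStructure.metric (𝒮 : ScalarStructure E N) : PseudoRiemannianMetric E N :=
  .ofRiemannian 𝒮.G

variable (E F S) in
/-- A duality structure `(S, D, ω)` on `N`: a flat connection and a parallel symplectic pairing on
the vector bundle `S`. -/
structure DualityStructure where
  /-- the flat connection -/
  D : CovariantDerivative 𝓘(ℝ, E) F S
  contMDiff_D : CovariantDerivative.ContMDiffCovariantDerivative D ∞
  flat : IsFlat F D
  /-- the symplectic pairing -/
  symp (y : N) : S y →L[ℝ] S y →L[ℝ] ℝ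
  contMDiff_symp : ContMDiff 𝓘(ℝ, E) (𝓘(ℝ, E).prod 𝓘(ℝ, F →L[ℝ] F →L[ℝ] ℝ)) ∞
    (fun y ↦ TotalSpace.mk' (F →L[ℝ] F →L[ℝ] ℝ)
      (E := fun y : N ↦ S y →L[ℝ] S y →L[ℝ] ℝ) y (symp y))
  symp_self (y : N) (s : S y) : symp y s s = 0
  symp_nondegenerate (y : N) (s : S y) (hs : ∀ t, symp y s t = 0) : s = 0
  symp_parallel (σ τ : Π y : N, S y) (y : N) (hσ : MDiffAt (T% σ) y) (hτ : MDiffAt (T% τ) y)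
    (u : TangentSpace 𝓘(ℝ, E) y) :
    (d% (fun z : N ↦ symp z (σ z) (τ z))) y u = symp y (D σ y u) (τ y) + symp y (σ y) (D τ y u)

/-- A taming of the symplectic vector bundle `(S, ω)`: a smooth complex structure `J` on `S`, which
is compatible with `ω` and for which `ω(J ·, ·)` is positive definite. -/
structure DualityStructure.IsTaming (Δ : DualityStructure E F S)
    (J : Π y : N, S y →L[ℝ] S y) : Prop where
  contMDiff : ContMDiff 𝓘(ℝ, E) (𝓘(ℝ, E).prod 𝓘(ℝ, F →L[ℝ] F)) ∞
    (fun y ↦ TotalSpace.mk' (F →L[ℝ] F) (E := fun y : N ↦ S y →L[ℝ] S y) y (J y))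
  sq (y : N) (s : S y) : J y (J y s) = -s
  compatible (y : N) (s t : S y) : Δ.symp y (J y s) (J y t) = Δ.symp y s t
  pos (y : N) (s : S y) (hs : s ≠ 0) : 0 < Δ.symp y (J y s) s

variable (E F S) in
/-- An electromagnetic structure `(S, D, J, ω)` on `N`. -/
structure ElectromagneticStructure extends DualityStructure E F S where
  /-- the taming -/
  J (y : N) : S y →L[ℝ] S y
  isTaming : toDualityStructure.IsTaming J

variable (E F S) in
/-- A scalar-electromagnetic structure: a scalar structure on `N` together with an electromagnetic
structure on `N`. -/
structure ScalarElectromagneticStructure where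
  /-- the scalar structure -/
  scalar : ScalarStructure E N
  /-- the electromagnetic structure -/
  em : ElectromagneticStructure E F S

namespace ElectromagneticStructure

variable (Ξ : ElectromagneticStructure E F S)

/-- The Euclidean scalar product `Q = ω(J ·, ·)`. -/
def Q (y : N) : S y →ₗ[ℝ] S y →ₗ[ℝ] ℝ :=
  (ContinuousLinearMap.coeLM ℝ).comp ((Ξ.symp y).comp (Ξ.J y)).toLinearMap

@[simp] lemma Q_apply (y : N) (s t : S y) : Ξ.Q y s t = Ξ.symp y (Ξ.J y s) t := rfl

lemma mdifferentiableAt_J {σ : Π y : N, S y} {y : N} (hσ : MDiffAt (T% σ) y) :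
    MDiffAt (T% (fun z ↦ Ξ.J z (σ z))) y :=
  MDifferentiableAt.clm_bundle_apply (F₁ := F) (F₂ := F)
    (Ξ.isTaming.contMDiff.mdifferentiableAt (by simp)) hσ

variable [FiniteDimensional ℝ F]

/-- `D ∘ J - J ∘ D` is `C^∞(N)`-linear. -/
lemma tensorialAt_fundamentalForm (y : N) :
    TensorialAt 𝓘(ℝ, E) F
      (fun σ : Π y : N, S y ↦ Ξ.D (fun z ↦ Ξ.J z (σ z)) y - (Ξ.J y).comp (Ξ.D σ y)) y where
  smul {f σ} hf hσ := by
    have e : (fun z ↦ Ξ.J z ((f • σ) z)) = f • fun z ↦ Ξ.J z (σ z) := by ext z; simp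
    rw [e, Ξ.D.isCovariantDerivativeOn.leibniz (Ξ.mdifferentiableAt_J hσ) hf, Ξ.D.isCovariantDerivativeOn.leibniz hσ hf]
    ext u
    simp
    module
  add {σ σ'} hσ hσ' := by
    have e : (fun z ↦ Ξ.J z ((σ + σ') z)) =
        (fun z ↦ Ξ.J z (σ z)) + fun z ↦ Ξ.J z (σ' z) := by ext z; simp
    rw [e, Ξ.D.isCovariantDerivativeOn.add (Ξ.mdifferentiableAt_J hσ) (Ξ.mdifferentiableAt_J hσ'), Ξ.D.isCovariantDerivativeOn.add hσ hσ']
    ext u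
    simp
    abel

/-- The fundamental form `Θ = D ∘ J - J ∘ D`, an `End(S)`-valued one-form:
`Θ(u) s = D_u (J σ) - J (D_u σ)` for any section `σ` with `σ y = s`. -/
def fundamentalForm (y : N) : TangentSpace 𝓘(ℝ, E) y →ₗ[ℝ] S y →ₗ[ℝ] S y :=
  ((ContinuousLinearMap.coeLM ℝ).comp
    (TensorialAt.mkHom (I := 𝓘(ℝ, E)) (F := F) _ y
      (Ξ.tensorialAt_fundamentalForm y)).toLinearMap).flip

lemma fundamentalForm_apply {σ : Π y : N, S y} {y : N} (hσ : MDiffAt (T% σ) y)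
    (u : TangentSpace 𝓘(ℝ, E) y) :
    Ξ.fundamentalForm y u (σ y) = Ξ.D (fun z ↦ Ξ.J z (σ z)) y u - Ξ.J y (Ξ.D σ y u) :=
  congr($(TensorialAt.mkHom_apply (I := 𝓘(ℝ, E)) (F := F)
    (Ξ.tensorialAt_fundamentalForm y) hσ) u)

end ElectromagneticStructure

/-- The fundamental field `Ψ = (♯ ⊗ id)(Θ)`, a section of `TN ⊗ End(S)`. -/
def ScalarElectromagneticStructure.fundamentalField [FiniteDimensional ℝ E] [FiniteDimensional ℝ F]
    (𝒟 : ScalarElectromagneticStructure E F S) (y : N) :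
    TangentSpace 𝓘(ℝ, E) y ⊗[ℝ] (S y →ₗ[ℝ] S y) :=
  TensorProduct.map (𝒟.scalar.metric.sharp y).toLinearMap LinearMap.id
    ((dualTensorHomEquiv ℝ (TangentSpace 𝓘(ℝ, E) y) (S y →ₗ[ℝ] S y)).symm
      (𝒟.em.fundamentalForm y))

end Structures

/-! ### Lorentzian four-manifolds -/

section Lorentzian

variable {M : Type*} [TopologicalSpace M] [ChartedSpace (EuclideanSpace ℝ (Fin 4)) M]

/-- Smooth vector fields on a four-manifold. -/
def IsSmoothVectorField [IsManifold (𝓡 4) ∞ M] (X : Π x : M, TangentSpace (𝓡 4) x) : Prop :=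
  ContMDiff (𝓡 4) (𝓡 4).tangent ∞ (fun x ↦ (X x : TangentBundle (𝓡 4) M))

variable (M) in
/-- An orientation of a four-manifold: a choice of orientation of each tangent space which is
locally constant in the trivializations of the tangent bundle induced by charts. -/
structure ManifoldOrientation [IsManifold (𝓡 4) ∞ M] where
  /-- the orientation of each tangent space -/
  toFun (x : M) : Orientation ℝ (TangentSpace (𝓡 4) x) (Fin 4)
  locallyConstant (x₀ : M) : ∃ o : Orientation ℝ (EuclideanSpace ℝ (Fin 4)) (Fin 4), ∀ᶠ x in 𝓝 x₀,
    ∀ hx : x ∈ (trivializationAt (EuclideanSpace ℝ (Fin 4)) (TangentSpace (𝓡 4)) x₀).baseSet,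
      Orientation.map (Fin 4) ((trivializationAt (EuclideanSpace ℝ (Fin 4)) (TangentSpace (𝓡 4)) x₀).continuousLinearEquivAt
        ℝ x hx).toLinearEquiv (toFun x) = o

variable (M) in
/-- A smooth metric of signature `(3,1)` on a four-manifold. -/
structure LorentzianMetric [IsManifold (𝓡 4) ∞ M] extends PseudoRiemannianMetric (EuclideanSpace ℝ (Fin 4)) M where
  signature (x : M) : ∃ e : Basis (Fin 4) ℝ (TangentSpace (𝓡 4) x),
    ∀ i j, val x (e i) (e j) = if i = j then (if i = 0 then -1 else 1) else 0

variable [IsManifold (𝓡 4) ∞ M]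

namespace LorentzianMetric

variable (g : LorentzianMetric M) (o : ManifoldOrientation M)

/-- The coordinate basis of the tangent space at `x`. The constructions below do not depend on
which basis is chosen. -/
def basis (x : M) : Basis (Fin 4) ℝ (TangentSpace (𝓡 4) x) :=
  (EuclideanSpace.basisFun (Fin 4) ℝ).toBasis

/-- The `g`-dual basis: `g (dualBasis i) (basis j) = δ i j`. -/
def dualBasis (x : M) : Basis (Fin 4) ℝ (TangentSpace (𝓡 4) x) :=
  (g.bilin x).dualBasis (g.bilin_nondegenerate x) (basis x)

/-- The trace with respect to `g`. -/
def trace {W : Type*} [AddCommGroup W] (x : M)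
    (B : TangentSpace (𝓡 4) x → TangentSpace (𝓡 4) x → W) : W :=
  ∑ i, B (basis x i) (g.dualBasis x i)

/-- The volume form of `g` and the orientation `o`. -/
def vol (x : M) : TangentSpace (𝓡 4) x [⋀^Fin 4]→ₗ[ℝ] ℝ :=
  √|(Matrix.of fun i j ↦ g.val x (basis x i) (basis x j)).det| • ((basis x).adjustToOrientation (o.toFun x)).det

variable {W : Type*} [AddCommGroup W] [Module ℝ W]

/-- The Hodge operator of `g` on `W`-valued two-forms:
`(∗ η) (u, v) = ½ η^{ij} vol (b i, b j, u, v)`, so that `α ∧ ∗ β = (α, β)_g vol`. -/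
def hodge (x : M) (η : TangentSpace (𝓡 4) x [⋀^Fin 2]→ₗ[ℝ] W) :
    TangentSpace (𝓡 4) x [⋀^Fin 2]→ₗ[ℝ] W :=
  (1 / 2 : ℝ) • ∑ i, ∑ j,
    (LinearMap.toSpanSingleton ℝ W (η ![g.dualBasis x i, g.dualBasis x j])).compAlternatingMap
      (((g.vol o x).curryLeft (basis x i)).curryLeft (basis x j))

/-- The scalar product induced on `W`-valued two-forms by `g` and a scalar product `Q` on `W`:
`(ρ, η) = ½ Q(ρ_{ij}, η^{ij})`, as a linear function of `η`. -/
def twoFormInner (x : M) (Q : W →ₗ[ℝ] W →ₗ[ℝ] ℝ) (ρ : TangentSpace (𝓡 4) x [⋀^Fin 2]→ₗ[ℝ] W) :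
    (TangentSpace (𝓡 4) x [⋀^Fin 2]→ₗ[ℝ] W) →ₗ[ℝ] ℝ where
  toFun η := (1 / 2 : ℝ) * ∑ i, ∑ j, Q (ρ ![basis x i, basis x j])
    (η ![g.dualBasis x i, g.dualBasis x j])
  map_add' η η' := by simp [Finset.sum_add_distrib, mul_add]
  map_smul' c η := by
    simp only [AlternatingMap.smul_apply, map_smul, smul_eq_mul, RingHom.id_apply, ← Finset.mul_sum]
    ring

/-- The extension of the scalar product of two-forms to a `T`-valued pairing `(ρ, t η)` between a
`W`-valued two-form `ρ` and the `T ⊗ W`-valued two-form obtained by letting `t ∈ T ⊗ End(W)` act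
on `η`. On pure tensors, `(ρ, (v ⊗ A) η) = (ρ, A η) v`. -/
def tensorPairing {T : Type*} [AddCommGroup T] [Module ℝ T] (x : M) (Q : W →ₗ[ℝ] W →ₗ[ℝ] ℝ)
    (ρ η : TangentSpace (𝓡 4) x [⋀^Fin 2]→ₗ[ℝ] W) (t : T ⊗[ℝ] (W →ₗ[ℝ] W)) : T :=
  TensorProduct.rid ℝ T <| LinearMap.lTensor T
    (g.twoFormInner x Q ρ ∘ₗ
      { toFun := fun A : W →ₗ[ℝ] W ↦ A.compAlternatingMap η
        map_add' := fun _ _ ↦ rfl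
        map_smul' := fun _ _ ↦ rfl }) t

end LorentzianMetric

end Lorentzian

/-! ### Configurations, field equations and solutions -/

section FieldEquations

variable {E : Type*} [NormedAddCommGroup E] [NormedSpace ℝ E]
  {N : Type*} [TopologicalSpace N] [ChartedSpace E N] [IsManifold 𝓘(ℝ, E) ∞ N]
  {F : Type*} [NormedAddCommGroup F] [NormedSpace ℝ F]
  {S : N → Type*} [TopologicalSpace (TotalSpace F S)]
  [∀ y, AddCommGroup (S y)] [∀ y, Module ℝ (S y)] [∀ y, TopologicalSpace (S y)]
  [∀ y, IsTopologicalAddGroup (S y)] [∀ y, ContinuousSMul ℝ (S y)]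
  [FiberBundle F S] [VectorBundle ℝ F S] [ContMDiffVectorBundle ∞ F S 𝓘(ℝ, E)]
  {M : Type*} [TopologicalSpace M] [ChartedSpace (EuclideanSpace ℝ (Fin 4)) M] [IsManifold (𝓡 4) ∞ M]

variable (E F S M) in
/-- A smooth map `φ : M → N` together with a smooth `S^φ`-valued two-form `V ∈ Ω²(M, S^φ)`.
Smoothness of `V` means that `V(X, Y)` is a smooth section of `S^φ`, that is, a smooth map into
the total space of `S` which covers `φ`, for all smooth vector fields `X`, `Y`. -/
@[ext]
structure FieldPair where
  /-- the scalar map -/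
  φ : M → N
  contMDiff_φ : ContMDiff (𝓡 4) 𝓘(ℝ, E) ∞ φ
  /-- the two-form -/
  V (x : M) : TangentSpace (𝓡 4) x [⋀^Fin 2]→ₗ[ℝ] S (φ x)
  contMDiff_V (X Y : Π x : M, TangentSpace (𝓡 4) x)
    (hX : IsSmoothVectorField X) (hY : IsSmoothVectorField Y) :
    ContMDiff (𝓡 4) (𝓘(ℝ, E).prod 𝓘(ℝ, F)) ∞
      (fun x ↦ TotalSpace.mk' F (E := S) (φ x) (V x ![X x, Y x]))

section Tension

variable [FiniteDimensional ℝ E]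

/-- The second fundamental form `∇ dφ` of `φ`, for the connection induced by the Levi-Civita
connections of `g` and `G`: `(∇ dφ)(u, v) = ∇^φ_u (dφ Y) - dφ (∇_u Y)` for a vector field `Y` with
`Y x = v`. -/
def secondFundamentalForm (g : LorentzianMetric M) (G : PseudoRiemannianMetric E N) (φ : M → N)
    (x : M) (u v : TangentSpace (𝓡 4) x) : TangentSpace 𝓘(ℝ, E) (φ x) :=
  pullbackConnection E G.leviCivita φ
      (fun x' ↦ mfderiv (𝓡 4) 𝓘(ℝ, E) φ x' (extend (EuclideanSpace ℝ (Fin 4)) v x')) x u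
    - mfderiv (𝓡 4) 𝓘(ℝ, E) φ x (g.leviCivita (extend (EuclideanSpace ℝ (Fin 4)) v) x u)

/-- The tension field `Tr_g ∇ dφ`. -/
def tensionField (g : LorentzianMetric M) (G : PseudoRiemannianMetric E N) (φ : M → N) (x : M) :
    TangentSpace 𝓘(ℝ, E) (φ x) :=
  g.trace x (secondFundamentalForm g G φ x)

/-- The gradient of the scalar potential. -/
def ScalarStructure.grad (𝒮 : ScalarStructure E N) (y : N) : TangentSpace 𝓘(ℝ, E) y :=
  𝒮.metric.sharp y ((d% 𝒮.Φ) y).toLinearMap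

/-- The modified tension field `θ_G(g, φ) - (grad Φ)^φ`. -/
def modifiedTensionField (g : LorentzianMetric M)
    (𝒮 : ScalarStructure E N) (φ : M → N) (x : M) : TangentSpace 𝓘(ℝ, E) (φ x) :=
  tensionField g 𝒮.metric φ x - 𝒮.grad (φ x)

end Tension

namespace FieldPair

/-- Positive polarization: `⋆ V = V`, where `⋆ = ∗_g ∘ J^φ` is the twisted Hodge operator. -/
def IsPositivelyPolarized (c : FieldPair E F S M) (o : ManifoldOrientation M)
    (g : LorentzianMetric M) (Ξ : ElectromagneticStructure E F S) : Prop :=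
  ∀ x : M, g.hodge o x ((Ξ.J (c.φ x)).toLinearMap.compAlternatingMap (c.V x)) = c.V x

/-- The scalar equation `θ_Σ(g, φ) - ½ (∗ V, Ψ^φ V) = 0`. -/
def SolvesScalar [FiniteDimensional ℝ E] [FiniteDimensional ℝ F] (c : FieldPair E F S M)
    (o : ManifoldOrientation M) (g : LorentzianMetric M)
    (𝒟 : ScalarElectromagneticStructure E F S) : Prop :=
  ∀ x : M, modifiedTensionField g 𝒟.scalar c.φ x
    - (1 / 2 : ℝ) • g.tensorPairing x (𝒟.em.Q (c.φ x)) (g.hodge o x (c.V x)) (c.V x)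
        (𝒟.fundamentalField (c.φ x)) = 0

/-- The twisted electromagnetic equation `d_{D^φ} V = 0`. -/
def SolvesElectromagnetic (c : FieldPair E F S M) (Δ : DualityStructure E F S) : Prop :=
  ∀ X Y Z : Π x : M, TangentSpace (𝓡 4) x,
    IsSmoothVectorField X → IsSmoothVectorField Y → IsSmoothVectorField Z →
      ∀ x : M, twistedExtDeriv F Δ.D c.φ c.V X Y Z x = 0

end FieldPair

namespace ScalarElectromagneticStructure

variable (𝒟 : ScalarElectromagneticStructure E F S) (o : ManifoldOrientation M)
  (g : LorentzianMetric M)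

/-- The set `Conf^g_𝒟(M)` of global scalar-electromagnetic configurations relative to `g`. -/
def Conf : Set (FieldPair E F S M) := {c | c.IsPositivelyPolarized o g 𝒟.em}

/-- The set `Sol^g_𝒟(M)` of global scalar-electromagnetic solutions relative to `g`. -/
def Sol [FiniteDimensional ℝ E] [FiniteDimensional ℝ F] : Set (FieldPair E F S M) :=
  {c | c ∈ 𝒟.Conf o g ∧ c.SolvesScalar o g 𝒟 ∧ c.SolvesElectromagnetic 𝒟.em.toDualityStructure}

end ScalarElectromagneticStructure

end FieldEquations

/-! ### Unbased automorphisms -/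

section Automorphisms

variable {E : Type*} [NormedAddCommGroup E] [NormedSpace ℝ E]
  {N : Type*} [TopologicalSpace N] [ChartedSpace E N] [IsManifold 𝓘(ℝ, E) ∞ N]
  {F : Type*} [NormedAddCommGroup F] [NormedSpace ℝ F]
  {S : N → Type*} [TopologicalSpace (TotalSpace F S)]
  [∀ y, AddCommGroup (S y)] [∀ y, Module ℝ (S y)] [∀ y, TopologicalSpace (S y)]
  [∀ y, IsTopologicalAddGroup (S y)] [∀ y, ContinuousSMul ℝ (S y)]
  [FiberBundle F S] [VectorBundle ℝ F S] [ContMDiffVectorBundle ∞ F S 𝓘(ℝ, E)]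
  {M : Type*} [TopologicalSpace M] [ChartedSpace (EuclideanSpace ℝ (Fin 4)) M]
  [IsManifold (𝓡 4) ∞ M]

variable (E F S) in
/-- An unbased automorphism of the vector bundle `S`: a diffeomorphism of the total space which
covers a diffeomorphism `base` of the base and restricts to linear isomorphisms of the fibers. -/
structure UnbasedAut where
  /-- the projection `f₀` to the base -/
  base : N ≃ₘ⟮𝓘(ℝ, E), 𝓘(ℝ, E)⟯ N
  /-- the fiber maps; they constitute the based isomorphism `f̂ : S → S^{f₀}` -/
  fiber (y : N) : S y ≃L[ℝ] S (base y)
  /-- the diffeomorphism of the total space -/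
  total : TotalSpace F S ≃ₘ⟮𝓘(ℝ, E).prod 𝓘(ℝ, F), 𝓘(ℝ, E).prod 𝓘(ℝ, F)⟯ TotalSpace F S
  total_mk (y : N) (s : S y) : total ⟨y, s⟩ = ⟨base y, fiber y s⟩

namespace UnbasedAut

/-- Transport along an equality of base points. -/
def fiberCast {y z : N} (h : y = z) : S y ≃L[ℝ] S z := by
  subst h
  exact ContinuousLinearEquiv.refl ℝ (S y)

lemma mk_fiberCast {y z : N} (h : y = z) (s : S y) :
    (⟨z, fiberCast h s⟩ : TotalSpace F S) = ⟨y, s⟩ := by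
  subst h
  rfl

lemma mk_section (σ : Π y : N, S y) {y z : N} (h : y = z) :
    (⟨y, σ y⟩ : TotalSpace F S) = ⟨z, σ z⟩ := by
  subst h
  rfl

@[ext] lemma ext {f f' : UnbasedAut E F S} (h : ∀ p, f.total p = f'.total p) : f = f' := by
  obtain ⟨b, φ, t, ht⟩ := f
  obtain ⟨b', φ', t', ht'⟩ := f'
  obtain rfl : t = t' := Diffeomorph.ext h
  obtain rfl : b = b' := Diffeomorph.ext fun y ↦ by
    simpa [ht] using congr_arg TotalSpace.proj (ht' y 0)
  obtain rfl : φ = φ' := by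
    funext y
    ext s
    simpa [ht] using ht' y s
  rfl

instance : Mul (UnbasedAut E F S) where
  mul f f' :=
    { base := f'.base.trans f.base
      fiber := fun y ↦ (f'.fiber y).trans (f.fiber (f'.base y))
      total := f'.total.trans f.total
      total_mk := fun y s ↦ by simp [total_mk]; rfl }

instance : One (UnbasedAut E F S) where
  one :=
    { base := Diffeomorph.refl _ _ _
      fiber := fun y ↦ ContinuousLinearEquiv.refl ℝ (S y)
      total := Diffeomorph.refl _ _ _
      total_mk := fun _ _ ↦ rfl }

instance : Inv (UnbasedAut E F S) where
  inv f :=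
    { base := f.base.symm
      fiber := fun y ↦ (fiberCast (f.base.apply_symm_apply y).symm).trans
        (f.fiber (f.base.symm y)).symm
      total := f.total.symm
      total_mk := fun y s ↦ by
        apply f.total.injective
        simp [total_mk, mk_fiberCast] }

lemma total_mul (f f' : UnbasedAut E F S) (p : TotalSpace F S) :
    (f * f').total p = f.total (f'.total p) := rfl

lemma total_one (p : TotalSpace F S) : (1 : UnbasedAut E F S).total p = p := rfl

lemma total_inv (f : UnbasedAut E F S) (p : TotalSpace F S) : f⁻¹.total p = f.total.symm p := rfl

/-- The group of unbased automorphisms, under composition. -/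
instance : Group (UnbasedAut E F S) where
  mul_assoc _ _ _ := by ext1 p; rfl
  one_mul _ := by ext1 p; rfl
  mul_one _ := by ext1 p; rfl
  inv_mul_cancel f := by ext1 p; simp [total_mul, total_inv, total_one]

@[simp] lemma base_mul (f f' : UnbasedAut E F S) (y : N) :
    (f * f').base y = f.base (f'.base y) := rfl

@[simp] lemma base_one (y : N) : (1 : UnbasedAut E F S).base y = y := rfl

@[simp] lemma base_inv (f : UnbasedAut E F S) (y : N) : f⁻¹.base y = f.base.symm y := rfl

@[simp] lemma fiber_mul (f f' : UnbasedAut E F S) (y : N) (s : S y) :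
    (f * f').fiber y s = f.fiber (f'.base y) (f'.fiber y s) := rfl

@[simp] lemma fiber_one (y : N) (s : S y) : (1 : UnbasedAut E F S).fiber y s = s := rfl

lemma fiber_fiber_inv (f : UnbasedAut E F S) (y : N) (s : S y) :
    f.fiber (f.base.symm y) (f⁻¹.fiber y s) = fiberCast (f.base.apply_symm_apply y).symm s :=
  (f.fiber (f.base.symm y)).apply_symm_apply _

/-- `f` is symplectic. -/
def IsSymplectic (f : UnbasedAut E F S) (Δ : DualityStructure E F S) : Prop :=
  ∀ (y : N) (s t : S y), Δ.symp (f.base y) (f.fiber y s) (f.fiber y t) = Δ.symp y s t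

/-- `f` is covariantly constant: whenever `τ = f ∘ σ ∘ f₀⁻¹` is the image under `f` of a section
`σ`, then `D_{df₀ u} τ = f (D_u σ)`. -/
def IsCovariantlyConstant (f : UnbasedAut E F S) (Δ : DualityStructure E F S) : Prop :=
  ∀ σ τ : Π y : N, S y, (∀ y, τ (f.base y) = f.fiber y (σ y)) →
    ∀ y : N, MDiffAt (T% σ) y → ∀ u : TangentSpace 𝓘(ℝ, E) y,
      Δ.D τ (f.base y) (mfderiv 𝓘(ℝ, E) 𝓘(ℝ, E) f.base y u) = f.fiber y (Δ.D σ y u)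

/-- The adjoint action `Ad(f)(J) = f ∘ J ∘ f⁻¹` on sections of `End(S)`. -/
def Ad (f : UnbasedAut E F S) (J : Π y : N, S y →L[ℝ] S y) (y : N) : S y →L[ℝ] S y :=
  let e : S (f.base.symm y) ≃L[ℝ] S y :=
    (f.fiber (f.base.symm y)).trans (fiberCast (f.base.apply_symm_apply y))
  (e : S (f.base.symm y) →L[ℝ] S y) ∘L J (f.base.symm y) ∘L (e.symm : S y →L[ℝ] S (f.base.symm y))

/-- `Ad(f)(J) = J'` if and only if `f ∘ J = J' ∘ f`. -/
lemma Ad_eq_iff (f : UnbasedAut E F S) (J J' : Π y : N, S y →L[ℝ] S y) :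
    f.Ad J = J' ↔ ∀ (y : N) (s : S y), f.fiber y (J y s) = J' (f.base y) (f.fiber y s) := by
  have key : ∀ (y x : N) (hx : x = f.base.symm y) (h : f.base x = y) (s : S x),
      f.Ad J y (fiberCast h (f.fiber x s)) = fiberCast h (f.fiber x (J x s)) := by
    rintro y x rfl h s
    simp [Ad]
  have key' (y : N) (s : S y) : f.Ad J (f.base y) (f.fiber y s) = f.fiber y (J y s) :=
    key (f.base y) y (f.base.symm_apply_apply y).symm rfl s
  constructor
  · rintro rfl y s
    exact (key' y s).symm
  · intro h
    funext z
    obtain ⟨y, rfl⟩ := f.base.surjective z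
    ext t
    obtain ⟨s, rfl⟩ := (f.fiber y).surjective t
    exact (key' y s).trans (h y s)

lemma total_section_iff (f : UnbasedAut E F S) (σ τ : Π y : N, S y) :
    (∀ y, τ (f.base y) = f.fiber y (σ y)) ↔ ∀ y, f.total ⟨y, σ y⟩ = ⟨f.base y, τ (f.base y)⟩ := by
  refine forall_congr' fun y ↦ ?_
  rw [total_mk]
  simp [eq_comm]

lemma mdifferentiableAt_image {f : UnbasedAut E F S} {σ τ : Π y : N, S y}
    (h : ∀ y, τ (f.base y) = f.fiber y (σ y)) {y : N} (hσ : MDiffAt (T% σ) y) :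
    MDiffAt (T% τ) (f.base y) := by
  have e : (T% τ) = f.total ∘ (T% σ) ∘ f.base.symm := by
    funext z
    obtain ⟨y, rfl⟩ := f.base.surjective z
    change _ = f.total ⟨_, σ (f.base.symm (f.base y))⟩
    rw [mk_section σ (f.base.symm_apply_apply y)]
    exact ((f.total_section_iff σ τ).1 h y).symm
  rw [e]
  refine (f.total.contMDiff.mdifferentiableAt (by simp)).comp _ ?_
  refine MDifferentiableAt.comp _ ?_ (f.base.symm.contMDiff.mdifferentiableAt (by simp))
  simpa using hσ

lemma exists_image (f : UnbasedAut E F S) (σ : Π y : N, S y) :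
    ∃ τ : Π y : N, S y, ∀ y, τ (f.base y) = f.fiber y (σ y) := by
  let τ : Π y : N, S y := fun y ↦ fiberCast (f.base.apply_symm_apply y)
    (f.fiber (f.base.symm y) (σ (f.base.symm y)))
  refine ⟨τ, (f.total_section_iff σ τ).2 fun y ↦ ?_⟩
  change _ = (⟨_, fiberCast _ _⟩ : TotalSpace F S)
  rw [mk_fiberCast, ← total_mk, mk_section σ (f.base.symm_apply_apply y)]

lemma mfderiv_base_mul (f f' : UnbasedAut E F S) (y : N) (u : TangentSpace 𝓘(ℝ, E) y) :
    mfderiv 𝓘(ℝ, E) 𝓘(ℝ, E) (f * f').base y u =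
      mfderiv 𝓘(ℝ, E) 𝓘(ℝ, E) f.base (f'.base y) (mfderiv 𝓘(ℝ, E) 𝓘(ℝ, E) f'.base y u) :=
  congr($(mfderiv_comp y (f.base.contMDiff.mdifferentiableAt (by simp))
    (f'.base.contMDiff.mdifferentiableAt (by simp))) u)

lemma mfderiv_base_inv (f : UnbasedAut E F S) (y : N) (u : TangentSpace 𝓘(ℝ, E) y) :
    mfderiv 𝓘(ℝ, E) 𝓘(ℝ, E) f.base (f.base.symm y)
      (mfderiv 𝓘(ℝ, E) 𝓘(ℝ, E) f⁻¹.base y u) = u := by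
  have e := mfderiv_comp y (f.base.contMDiff.mdifferentiableAt (by simp))
    (f.base.symm.contMDiff.mdifferentiableAt (x := y) (by simp) :
      MDifferentiableAt 𝓘(ℝ, E) 𝓘(ℝ, E) f.base.symm y)
  have e' : f.base ∘ f.base.symm = id := funext f.base.apply_symm_apply
  rw [e', mfderiv_id] at e
  exact congr($e.symm u)

lemma IsCovariantlyConstant.mul {f f' : UnbasedAut E F S} {Δ : DualityStructure E F S}
    (hf : f.IsCovariantlyConstant Δ) (hf' : f'.IsCovariantlyConstant Δ) :
    (f * f').IsCovariantlyConstant Δ := by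
  intro σ τ h y hσ u
  obtain ⟨ρ, hρ⟩ := f'.exists_image σ
  have hτ : ∀ y, τ (f.base y) = f.fiber y (ρ y) := fun z ↦ by
    obtain ⟨y, rfl⟩ := f'.base.surjective z
    exact (h y).trans congr(f.fiber _ $(hρ y)).symm
  have e := hf ρ τ hτ (f'.base y) (mdifferentiableAt_image hρ hσ)
    (mfderiv 𝓘(ℝ, E) 𝓘(ℝ, E) f'.base y u)
  rw [hf' σ ρ hρ y hσ u, ← mfderiv_base_mul] at e
  exact e

lemma IsCovariantlyConstant.inv {f : UnbasedAut E F S} {Δ : DualityStructure E F S}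
    (hf : f.IsCovariantlyConstant Δ) : f⁻¹.IsCovariantlyConstant Δ := by
  intro σ τ h y hσ u
  have hτ : ∀ z, σ (f.base z) = f.fiber z (τ z) := by
    rw [total_section_iff] at h ⊢
    intro z
    have := h (f.base z)
    rw [base_inv, mk_section τ (f.base.symm_apply_apply z)] at this
    rw [← this, total_inv, Diffeomorph.apply_symm_apply]
  have cast (y' : N) (hy : y' = y) (w : E) :
      fiberCast hy.symm (Δ.D σ y (w : TangentSpace 𝓘(ℝ, E) y))
        = Δ.D σ y' (w : TangentSpace 𝓘(ℝ, E) y') := by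
    subst hy
    rfl
  have hd : MDiffAt (T% τ) (f.base.symm y) := mdifferentiableAt_image (f := f⁻¹) h hσ
  have e := hf τ σ hτ (f.base.symm y) hd (mfderiv 𝓘(ℝ, E) 𝓘(ℝ, E) f⁻¹.base y u)
  rw [mfderiv_base_inv] at e
  refine (f.fiber (f.base.symm y)).injective (e.symm.trans ?_)
  refine (cast _ (f.base.apply_symm_apply y) u).symm.trans ?_
  exact ((f.fiber (f.base.symm y)).apply_symm_apply _).symm

end UnbasedAut

/-- The group `Aut^ub(Δ)` of symmetries of a duality structure. -/
def DualityStructure.Aut (Δ : DualityStructure E F S) : Subgroup (UnbasedAut E F S) where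
  carrier := {f | f.IsSymplectic Δ ∧ f.IsCovariantlyConstant Δ}
  one_mem' := by
    refine ⟨fun y s t ↦ rfl, fun σ τ h y hσ u ↦ ?_⟩
    obtain rfl : τ = σ := funext h
    exact congr(Δ.D τ y ($(mfderiv_id) u))
  mul_mem' := by
    rintro f f' ⟨h1, h2⟩ ⟨h1', h2'⟩
    exact ⟨fun y s t ↦ (h1 _ _ _).trans (h1' _ _ _), h2.mul h2'⟩
  inv_mem' := by
    rintro f ⟨h1, h2⟩
    refine ⟨fun y s t ↦ ?_, h2.inv⟩
    refine (h1 (f.base.symm y) (f⁻¹.fiber y s) (f⁻¹.fiber y t)).symm.trans ?_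
    rw [UnbasedAut.fiber_fiber_inv, UnbasedAut.fiber_fiber_inv]
    have key (y' : N) (hy : y = y') (s t : S y) :
        Δ.symp y' (UnbasedAut.fiberCast hy s) (UnbasedAut.fiberCast hy t) = Δ.symp y s t := by
      subst hy
      rfl
    exact key _ _ s t

/-- The group `Aut(Σ)` of isometries of the scalar manifold which preserve the scalar potential, as
a predicate on diffeomorphisms. -/
def ScalarStructure.IsAut (𝒮 : ScalarStructure E N) (ψ : N ≃ₘ⟮𝓘(ℝ, E), 𝓘(ℝ, E)⟯ N) : Prop :=
  (∀ (y : N) (u v : TangentSpace 𝓘(ℝ, E) y),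
    𝒮.G.inner (ψ y) (mfderiv 𝓘(ℝ, E) 𝓘(ℝ, E) ψ y u) (mfderiv 𝓘(ℝ, E) 𝓘(ℝ, E) ψ y v) =
      𝒮.G.inner y u v) ∧
  ∀ y : N, 𝒮.Φ (ψ y) = 𝒮.Φ y

namespace ScalarElectromagneticStructure

variable (𝒟 : ScalarElectromagneticStructure E F S)

/-- The scalar-electromagnetic duality group `Aut(𝒟₀)`. -/
def dualityGroup : Subgroup (UnbasedAut E F S) where
  carrier := {f | f ∈ 𝒟.em.toDualityStructure.Aut ∧ 𝒟.scalar.IsAut f.base}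
  one_mem' := ⟨one_mem _, fun y u v ↦ congr(𝒟.scalar.G.inner y ($(mfderiv_id) u) ($(mfderiv_id) v)),
    fun y ↦ rfl⟩
  mul_mem' := by
    rintro f f' ⟨h, h1, h2⟩ ⟨h', h1', h2'⟩
    refine ⟨mul_mem h h', fun y u v ↦ ?_, fun y ↦ (h2 _).trans (h2' _)⟩
    rw [UnbasedAut.mfderiv_base_mul, UnbasedAut.mfderiv_base_mul]
    exact (h1 _ _ _).trans (h1' _ _ _)
  inv_mem' := by
    rintro f ⟨h, h1, h2⟩
    refine ⟨inv_mem h, fun y u v ↦ ?_, fun y ↦ ?_⟩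
    · refine (h1 (f.base.symm y) (mfderiv 𝓘(ℝ, E) 𝓘(ℝ, E) f⁻¹.base y u)
        (mfderiv 𝓘(ℝ, E) 𝓘(ℝ, E) f⁻¹.base y v)).symm.trans ?_
      rw [UnbasedAut.mfderiv_base_inv, UnbasedAut.mfderiv_base_inv]
      have key (y' : N) (hy : y' = y) (u v : E) :
          𝒟.scalar.G.inner y' (u : TangentSpace 𝓘(ℝ, E) y') (v : TangentSpace 𝓘(ℝ, E) y') =
            𝒟.scalar.G.inner y (u : TangentSpace 𝓘(ℝ, E) y) (v : TangentSpace 𝓘(ℝ, E) y) := by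
        subst hy
        rfl
      exact key _ (f.base.apply_symm_apply y) u v
    · refine (h2 (f.base.symm y)).symm.trans ?_
      rw [Diffeomorph.apply_symm_apply]

/-- The scalar-electromagnetic symmetry group `Aut(𝒟)`: the dualities `f` with `Ad(f)(J) = J`. -/
def symmetryGroup : Subgroup (UnbasedAut E F S) where
  carrier := {f | f ∈ 𝒟.dualityGroup ∧ f.Ad 𝒟.em.J = 𝒟.em.J}
  one_mem' := ⟨one_mem _, (UnbasedAut.Ad_eq_iff _ _ _).2 fun _ _ ↦ rfl⟩
  mul_mem' := by
    rintro f f' ⟨h, h1⟩ ⟨h', h1'⟩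
    rw [UnbasedAut.Ad_eq_iff] at h1 h1'
    refine ⟨mul_mem h h', (UnbasedAut.Ad_eq_iff _ _ _).2 fun y s ↦ ?_⟩
    rw [UnbasedAut.fiber_mul, h1', h1]
    rfl
  inv_mem' := by
    rintro f ⟨h, h1⟩
    rw [UnbasedAut.Ad_eq_iff] at h1
    refine ⟨inv_mem h, (UnbasedAut.Ad_eq_iff _ _ _).2 fun y s ↦ ?_⟩
    apply (f.fiber (f.base.symm y)).injective
    refine (f.fiber_fiber_inv y _).trans (Eq.trans ?_ (h1 (f.base.symm y) (f⁻¹.fiber y s)).symm)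
    rw [UnbasedAut.fiber_fiber_inv]
    have key (y' : N) (hy : y = y') (s : S y) :
        UnbasedAut.fiberCast hy (𝒟.em.J y s) = 𝒟.em.J y' (UnbasedAut.fiberCast hy s) := by
      subst hy
      rfl
    exact key _ _ s

end ScalarElectromagneticStructure

/-- The duality action `f ⋄ (φ, V) = (f₀ ∘ φ, f̂^φ(V))`. -/
instance : MulAction (UnbasedAut E F S) (FieldPair E F S M) where
  smul f c :=
    { φ := f.base ∘ c.φ
      contMDiff_φ := f.base.contMDiff.comp c.contMDiff_φ
      V := fun x ↦ (f.fiber (c.φ x)).toLinearEquiv.toLinearMap.compAlternatingMap (c.V x)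
      contMDiff_V := fun X Y hX hY ↦ by
        convert f.total.contMDiff.comp (c.contMDiff_V X Y hX hY) using 1
        funext x
        exact (f.total_mk _ _).symm }
  one_smul _ := rfl
  mul_smul _ _ _ := rfl

end Automorphisms

end ESM

end

/-! Every ingredient of the equations is natural under `f`. For a configuration `c = (φ, V)` with
image `f • c`, the left-hand side of the scalar equation for `f • c` is `df₀` applied to the one for
`c`, that of the electromagnetic equation is `f̂` applied to the one for `c`, and the polarization
condition is transported because `f` commutes with `J`. Hence `f` sends solutions to solutions. The
symmetries form a group that acts, so the same statement for `f⁻¹` gives the converse and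
surjectivity.

The analytic core is `UnbasedAut.pullbackConnection_image`: a bundle automorphism that commutes with
a connection also intertwines the connections pulled back along `φ` and `f₀ ∘ φ`. The pulled-back
connection is defined by the preferred trivialization, which `f` need not respect. It is therefore
first characterized by the Leibniz rule on combinations `∑ aᵢ • (σᵢ ∘ φ)`
(`pullbackConnection_eq_sum`); `f` moves the `σᵢ` and leaves the `aᵢ` alone.

This lemma is used twice. With `D` it gives the electromagnetic equation. With the Levi-Civita
connection of the scalar metric and the automorphism `df₀` of the tangent bundle (`tangentAut`) it
gives naturality of the second fundamental form, since isometries preserve the Koszul formula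
(`IsIsometry.leviCivita_image`).

For the source term, `tensorPairing_map_dual` rewrites `(∗V, ΨV)` as the metric dual of the one-form
`u ↦ (∗V, Θ(u)V)`. That one-form is invariant because `f` preserves `Q` and `Θ` and commutes with
the Hodge operator; the isometry `f₀` then carries its dual along. -/

noncomputable section

namespace ESM

/-! ### Pulled-back connections and bundle automorphisms -/

section PullbackConnection

variable {E : Type*} [NormedAddCommGroup E] [NormedSpace ℝ E]
  {N : Type*} [TopologicalSpace N] [ChartedSpace E N] [IsManifold 𝓘(ℝ, E) ∞ N]
  {F : Type*} [NormedAddCommGroup F] [NormedSpace ℝ F]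
  {S : N → Type*} [TopologicalSpace (TotalSpace F S)]
  [∀ y, AddCommGroup (S y)] [∀ y, Module ℝ (S y)] [∀ y, TopologicalSpace (S y)]
  [∀ y, IsTopologicalAddGroup (S y)] [∀ y, ContinuousSMul ℝ (S y)]
  [FiberBundle F S] [VectorBundle ℝ F S] [ContMDiffVectorBundle ∞ F S 𝓘(ℝ, E)]
  {E' : Type*} [NormedAddCommGroup E'] [NormedSpace ℝ E']
  {M : Type*} [TopologicalSpace M] [ChartedSpace E' M]

/-- The coordinates of a section along `φ` in the preferred trivialization at `φ x`. -/
def coordAt (F : Type*) [NormedAddCommGroup F] [NormedSpace ℝ F]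
    {S : N → Type*} [TopologicalSpace (TotalSpace F S)] [∀ y, TopologicalSpace (S y)]
    [FiberBundle F S] (φ : M → N) (s : Π x : M, S (φ x)) (x x' : M) : F :=
  (trivializationAt F S (φ x) ⟨φ x', s x'⟩).2

lemma mdifferentiableAt_coordAt {φ : M → N} {s : Π x : M, S (φ x)} {x : M}
    (hs : MDifferentiableAt 𝓘(ℝ, E') (𝓘(ℝ, E).prod 𝓘(ℝ, F))
      (fun x' ↦ TotalSpace.mk' F (φ x') (s x')) x) :
    MDiffAt (coordAt F φ s x) x :=
  ((mdifferentiableAt_totalSpace _ _).1 hs).2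

lemma eventually_mem_baseSet {φ : M → N} {x : M} (hφ : ContinuousAt φ x) :
    ∀ᶠ x' in 𝓝 x, φ x' ∈ (trivializationAt F S (φ x)).baseSet :=
  hφ ((trivializationAt F S (φ x)).open_baseSet.mem_nhds (mem_baseSet_trivializationAt F S (φ x)))

/-- A trivialization is fiberwise linear over its base set, where it agrees with the bundled map
`linearMapAt`. -/
lemma coordAt_sum_smul {φ : M → N} {ι : Type*} (I : Finset ι) (a : ι → M → ℝ)
    (s : ι → Π x : M, S (φ x)) {x x' : M}
    (hx' : φ x' ∈ (trivializationAt F S (φ x)).baseSet) :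
    coordAt F φ (fun x' ↦ ∑ i ∈ I, a i x' • s i x') x x' =
      ∑ i ∈ I, a i x' • coordAt F φ (s i) x x' := by
  have e := (trivializationAt F S (φ x)).coe_linearMapAt_of_mem (R := ℝ) hx'
  have h (v : S (φ x')) : (trivializationAt F S (φ x) ⟨φ x', v⟩).2 =
    (trivializationAt F S (φ x)).linearMapAt ℝ (φ x') v := by rw [e]
  simp only [coordAt, h, map_sum, map_smul]

lemma coordAt_congr {φ : M → N} {s s' : Π x : M, S (φ x)} {x : M}
    (h : ∀ᶠ x' in 𝓝 x, s x' = s' x') : coordAt F φ s x =ᶠ[𝓝 x] coordAt F φ s' x :=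
  h.mono fun x' hx' ↦ by simp [coordAt, hx']

lemma mvfderiv_congr {V : Type*} [NormedAddCommGroup V] [NormedSpace ℝ V] {a b : M → V} {x : M}
    (h : a =ᶠ[𝓝 x] b) : (d% a) x = (d% b) x := by
  ext u
  exact congr($(h.mfderiv_eq (I := 𝓘(ℝ, E')) (I' := 𝓘(ℝ, V))) u)

/-- Differentiability and the product rule are proved together, because the inductive step of the
rule needs the remaining sum to be differentiable. -/
lemma mdifferentiableAt_and_mvfderiv_sum_smul {V : Type*} [NormedAddCommGroup V] [NormedSpace ℝ V]
    {ι : Type*} (I : Finset ι) {a : ι → M → ℝ} {b : ι → M → V} {x : M}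
    (ha : ∀ i ∈ I, MDiffAt (a i) x) (hb : ∀ i ∈ I, MDiffAt (b i) x) (u : TangentSpace 𝓘(ℝ, E') x) :
    MDiffAt (fun x' ↦ ∑ i ∈ I, a i x' • b i x') x ∧
    (d% (fun x' ↦ ∑ i ∈ I, a i x' • b i x')) x u =
      ∑ i ∈ I, (a i x • (d% (b i)) x u + (d% (a i)) x u • b i x) := by
  classical
  induction I using Finset.induction_on with
  | empty =>
    simp only [Finset.sum_empty]
    exact ⟨mdifferentiableAt_const, by rw [mvfderiv_const]; rfl⟩
  | insert j I hj ih =>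
    obtain ⟨h1, h2⟩ := ih (fun i hi ↦ ha i (by simp [hi])) (fun i hi ↦ hb i (by simp [hi]))
    have hj1 := ha j (by simp)
    have hj2 := hb j (by simp)
    have hj3 : MDiffAt (fun x' ↦ a j x' • b j x') x := hj1.smul hj2
    simp only [Finset.sum_insert hj]
    refine ⟨hj3.add h1, ?_⟩
    rw [mvfderiv_fun_add hj3 h1, mvfderiv_fun_smul hj1 hj2, ← h2]
    rfl


variable [FiniteDimensional ℝ E] [FiniteDimensional ℝ F]

lemma mdifferentiableAt_section_iff {σ : Π y : N, S y} {y : N} :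
    MDiffAt (T% σ) y ↔ MDiffAt (coordAt F id σ y) y := by
  rw [mdifferentiableAt_totalSpace]
  exact and_iff_right mdifferentiableAt_id

/-- Two connections obey the same Leibniz rule, so the derivative terms cancel in their difference.
Here the second connection is the flat one given by the preferred trivialization at `y`. -/
lemma tensorialAt_sub_coordAt (D : CovariantDerivative 𝓘(ℝ, E) F S) (y : N) :
    TensorialAt 𝓘(ℝ, E) F (fun σ : Π y : N, S y ↦ D σ y -
      (trivializationAt F S y).symmL ℝ y ∘L (d% (coordAt F id σ y)) y) y where
  smul {a σ} ha hσ := by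
    have h := mdifferentiableAt_section_iff.1 hσ
    have e : coordAt F id (a • σ) y =ᶠ[𝓝 y] a • coordAt F id σ y := by
      filter_upwards [eventually_mem_baseSet (F := F) (S := S) (φ := id) (x := y) continuousAt_id]
        with z hz
      simpa using! coordAt_sum_smul (φ := id) (F := F) {()} (fun _ ↦ a) (fun _ ↦ σ) hz
    have e' : (trivializationAt F S y).symm y (coordAt F id σ y y) = σ y := by
      simp [coordAt, mem_baseSet_trivializationAt' y]
    rw [mvfderiv_congr e, D.isCovariantDerivativeOn.leibniz hσ ha, mvfderiv_smul ha h]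
    ext u
    simp [mem_baseSet_trivializationAt' y, e']
    module
  add {σ σ'} hσ hσ' := by
    have h := mdifferentiableAt_section_iff.1 hσ
    have h' := mdifferentiableAt_section_iff.1 hσ'
    have e : coordAt F id (σ + σ') y =ᶠ[𝓝 y] coordAt F id σ y + coordAt F id σ' y := by
      filter_upwards [eventually_mem_baseSet (F := F) (S := S) (φ := id) (x := y) continuousAt_id]
        with z hz
      simpa using! coordAt_sum_smul (φ := id) (F := F) Finset.univ (fun _ _ ↦ 1)
        (fun i : Bool ↦ cond i σ σ') hz
    rw [mvfderiv_congr e, D.isCovariantDerivativeOn.add hσ hσ', mvfderiv_add h h']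
    ext u
    simp
    abel

/-- The connection form of `D` in the preferred trivialization at `y`. -/
def connectionForm (D : CovariantDerivative 𝓘(ℝ, E) F S) (y : N) :
    S y →L[ℝ] TangentSpace 𝓘(ℝ, E) y →L[ℝ] S y :=
  TensorialAt.mkHom _ y (tensorialAt_sub_coordAt D y)

lemma apply_eq_connectionForm (D : CovariantDerivative 𝓘(ℝ, E) F S) {σ : Π y : N, S y} {y : N}
    (hσ : MDiffAt (T% σ) y) (v : TangentSpace 𝓘(ℝ, E) y) :
    D σ y v = (trivializationAt F S y).symm y ((d% (coordAt F id σ y)) y v)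
      + connectionForm D y (σ y) v := by
  rw [connectionForm, TensorialAt.mkHom_apply (tensorialAt_sub_coordAt D y) hσ]
  simp [mem_baseSet_trivializationAt' y]

/-- `extend F s` has constant coordinates near `y`, so only the connection form survives. This
identifies the second summand in the definition of `pullbackConnection`. -/
lemma apply_extend_eq_connectionForm (D : CovariantDerivative 𝓘(ℝ, E) F S) {y : N} (s : S y)
    (v : TangentSpace 𝓘(ℝ, E) y) :
    D (extend F s) y v = connectionForm D y s v := by
  have e : coordAt F id (extend F s : Π y : N, S y) y =ᶠ[𝓝 y]
      fun _ ↦ (trivializationAt F S y ⟨y, s⟩).2 := by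
    filter_upwards [eventually_mem_baseSet (F := F) (S := S) (φ := id) (x := y) continuousAt_id]
        with z hz
    have h := congr_arg Prod.snd
      ((trivializationAt F S y).apply_mk_symm hz (trivializationAt F S y ⟨y, s⟩).2)
    exact h
  rw [apply_eq_connectionForm D (mdifferentiableAt_extend ..), mvfderiv_congr e, mvfderiv_const]
  simpa [mem_baseSet_trivializationAt' y] using!
    ((trivializationAt F S y).symmₗ ℝ y).map_zero

/-- The pulled-back connection, applied to a linear combination of pulled-back sections. -/
lemma pullbackConnection_eq_sum (D : CovariantDerivative 𝓘(ℝ, E) F S) {φ : M → N} {x : M}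
    (hφ : MDifferentiableAt 𝓘(ℝ, E') 𝓘(ℝ, E) φ x) {s : Π x : M, S (φ x)}
    {ι : Type*} [Fintype ι] {a : ι → M → ℝ} {σ : ι → Π y : N, S y}
    (ha : ∀ i, MDiffAt (a i) x) (hσ : ∀ i, MDiffAt (T% (σ i)) (φ x))
    (hs : ∀ᶠ x' in 𝓝 x, s x' = ∑ i, a i x' • σ i (φ x')) (u : TangentSpace 𝓘(ℝ, E') x) :
    pullbackConnection F D φ s x u =
      ∑ i, ((d% (a i)) x u • σ i (φ x)
        + a i x • D (σ i) (φ x) (mfderiv 𝓘(ℝ, E') 𝓘(ℝ, E) φ x u)) := by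
  have hb (i) : MDiffAt (coordAt F id (σ i) (φ x)) (φ x) := mdifferentiableAt_section_iff.1 (hσ i)
  have hc (i) : MDiffAt (coordAt F φ (fun x' ↦ σ i (φ x')) x) x := (hb i).comp x hφ
  have hc' (i) : (d% (coordAt F φ (fun x' ↦ σ i (φ x')) x)) x u =
      (d% (coordAt F id (σ i) (φ x))) (φ x) (mfderiv 𝓘(ℝ, E') 𝓘(ℝ, E) φ x u) :=
    congr($(mfderiv_comp x (hb i) hφ) u)
  have e : coordAt F φ s x =ᶠ[𝓝 x] fun x' ↦ ∑ i, a i x' • coordAt F φ (fun x' ↦ σ i (φ x')) x x' :=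
    (coordAt_congr hs).trans ((eventually_mem_baseSet hφ.continuousAt).mono fun x' hx' ↦
      coordAt_sum_smul _ _ _ hx')
  -- The inverse trivialization is replaced by its bundled linear version, so that sums and scalars
  -- can be pulled out of it.
  have hsymm : ⇑((trivializationAt F S (φ x)).symmₗ ℝ (φ x)) =
      (trivializationAt F S (φ x)).symm (φ x) :=
    (trivializationAt F S (φ x)).coe_symmₗ (R := ℝ) (mem_baseSet_trivializationAt' (φ x))
  have e' (i) : (trivializationAt F S (φ x)).symmₗ ℝ (φ x)
      (coordAt F φ (fun x' ↦ σ i (φ x')) x x) = σ i (φ x) := by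
    rw [hsymm]
    simp [coordAt, mem_baseSet_trivializationAt' (φ x)]
  have key : pullbackConnection F D φ s x u = (trivializationAt F S (φ x)).symmₗ ℝ (φ x)
      ((d% (coordAt F φ s x)) x u) + D (extend F (s x)) (φ x) (mfderiv 𝓘(ℝ, E') 𝓘(ℝ, E) φ x u) := by
    rw [hsymm]
    rfl
  rw [key, mvfderiv_congr e,
    (mdifferentiableAt_and_mvfderiv_sum_smul _ (fun i _ ↦ ha i) (fun i _ ↦ hc i) u).2,
    apply_extend_eq_connectionForm, hs.self_of_nhds]
  simp only [map_sum, map_add, map_smul, e', hc', sum_apply,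
    smul_apply, ← Finset.sum_add_distrib]
  refine Finset.sum_congr rfl fun i _ ↦ ?_
  -- The terms `aᵢ dσᵢ` of the product rule and the terms `aᵢ A σᵢ` of the connection form
  -- reassemble into `aᵢ D σᵢ`.
  rw [apply_eq_connectionForm D (hσ i), ← hsymm]
  module

/-- The `σ i` form the local frame of the preferred trivialization at `φ x` for a basis of `F`, and
the `a i` are the coordinates of `s` in it. Thus the Leibniz characterization applies to every
differentiable section along `φ`. -/
lemma exists_frame_expansion {φ : M → N} {s : Π x : M, S (φ x)} {x : M}
    (hs : MDifferentiableAt 𝓘(ℝ, E') (𝓘(ℝ, E).prod 𝓘(ℝ, F))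
      (fun x' ↦ TotalSpace.mk' F (φ x') (s x')) x) :
    ∃ (a : Fin (finrank ℝ F) → M → ℝ) (σ : Fin (finrank ℝ F) → Π y : N, S y),
      (∀ i, MDiffAt (a i) x) ∧ (∀ i, MDiffAt (T% (σ i)) (φ x)) ∧
      ∀ᶠ x' in 𝓝 x, s x' = ∑ i, a i x' • σ i (φ x') := by
  let b := finBasis ℝ F
  let e := trivializationAt F S (φ x)
  have hφ : ContinuousAt φ x := ((mdifferentiableAt_totalSpace _ _).1 hs).1.continuousAt
  refine ⟨fun i x' ↦ b.repr (coordAt F φ s x x') i, fun i ↦ e.localFrame b i, fun i ↦ ?_,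
    fun i ↦ ?_, ?_⟩
  · exact ((b.coord i).toContinuousLinearMap.differentiableAt.mdifferentiableAt).comp x
      (mdifferentiableAt_coordAt hs)
  · exact (contMDiffAt_localFrame_of_mem 1 e b i
      (mem_baseSet_trivializationAt' (φ x))).mdifferentiableAt (by simp)
  · filter_upwards [eventually_mem_baseSet (S := S) (F := F) hφ] with x' hx'
    have h1 (i) : e.localFrame b i (φ x') = e.symmₗ ℝ (φ x') (b i) := by
      rw [e.localFrame_apply_of_mem_baseSet b hx', e.symmₗ_apply hx']
      simp [Trivialization.basisAt]
    simp only [h1, ← map_smul, ← map_sum, b.sum_repr]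
    rw [e.coe_symmₗ (R := ℝ) hx']
    simp [coordAt, e, hx']

/-- A covariantly constant bundle automorphism intertwines pulled-back connections. -/
lemma UnbasedAut.pullbackConnection_image (f : UnbasedAut E F S)
    (D : CovariantDerivative 𝓘(ℝ, E) F S)
    (hf : ∀ σ τ : Π y : N, S y, (∀ y, τ (f.base y) = f.fiber y (σ y)) →
      ∀ y : N, MDiffAt (T% σ) y → ∀ u : TangentSpace 𝓘(ℝ, E) y,
        D τ (f.base y) (mfderiv 𝓘(ℝ, E) 𝓘(ℝ, E) f.base y u) = f.fiber y (D σ y u))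
    {φ : M → N} {s : Π x : M, S (φ x)} {x : M}
    (hs : MDifferentiableAt 𝓘(ℝ, E') (𝓘(ℝ, E).prod 𝓘(ℝ, F))
      (fun x' ↦ TotalSpace.mk' F (φ x') (s x')) x) (u : TangentSpace 𝓘(ℝ, E') x) :
    pullbackConnection F D (f.base ∘ φ) (fun x' ↦ f.fiber (φ x') (s x')) x u =
      f.fiber (φ x) (pullbackConnection F D φ s x u) := by
  obtain ⟨a, σ, ha, hσ, hsum⟩ := exists_frame_expansion hs
  choose τ hτ using fun i ↦ f.exists_image (σ i)
  have hφ : MDifferentiableAt 𝓘(ℝ, E') 𝓘(ℝ, E) φ x := ((mdifferentiableAt_totalSpace _ _).1 hs).1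
  have hbase : MDifferentiableAt 𝓘(ℝ, E) 𝓘(ℝ, E) f.base (φ x) :=
    f.base.contMDiff.mdifferentiableAt (by simp)
  -- Fiberwise linearity gives the image section the same coefficients `a i` in the transported
  -- frame, so the two Leibniz expansions can be compared term by term.
  have hsum' : ∀ᶠ x' in 𝓝 x, f.fiber (φ x') (s x') = ∑ i, a i x' • τ i ((f.base ∘ φ) x') := by
    filter_upwards [hsum] with x' hx'
    simp [hx', hτ]
  rw [pullbackConnection_eq_sum D hφ ha hσ hsum u,
    pullbackConnection_eq_sum D (hbase.comp x hφ) ha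
      (fun i ↦ UnbasedAut.mdifferentiableAt_image (hτ i) (hσ i)) hsum' u, map_sum]
  refine Finset.sum_congr rfl fun i _ ↦ ?_
  rw [map_add, map_smul, map_smul, ← hf _ _ (hτ i) _ (hσ i), mfderiv_comp x hbase hφ]
  congr 2
  exact hτ i (φ x)

end PullbackConnection

/-! ### Isometries, the Levi-Civita connection and the musical isomorphism -/

section Isometries

variable {E : Type*} [NormedAddCommGroup E] [NormedSpace ℝ E]
  {N : Type*} [TopologicalSpace N] [ChartedSpace E N] [IsManifold 𝓘(ℝ, E) ∞ N]

/-- The differential of a diffeomorphism, as an unbased automorphism of the tangent bundle. -/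
def tangentAut (ψ : N ≃ₘ⟮𝓘(ℝ, E), 𝓘(ℝ, E)⟯ N) :
    UnbasedAut E E (TangentSpace 𝓘(ℝ, E) : N → Type _) where
  base := ψ
  fiber y := ψ.mfderivToContinuousLinearEquiv (by simp) y
  total :=
    { toFun := tangentMap 𝓘(ℝ, E) 𝓘(ℝ, E) ψ
      invFun := tangentMap 𝓘(ℝ, E) 𝓘(ℝ, E) ψ.symm
      left_inv := fun p ↦ by
        have h := tangentMap_comp_at (I := 𝓘(ℝ, E)) (I' := 𝓘(ℝ, E)) (I'' := 𝓘(ℝ, E))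
          (g := ψ.symm) (f := ψ) p
          (ψ.symm.contMDiff.mdifferentiableAt (by simp)) (ψ.contMDiff.mdifferentiableAt (by simp))
        have e : ψ.symm ∘ ψ = id := funext ψ.symm_apply_apply
        rw [← h, e, tangentMap_id, id]
      right_inv := fun p ↦ by
        have h := tangentMap_comp_at (I := 𝓘(ℝ, E)) (I' := 𝓘(ℝ, E)) (I'' := 𝓘(ℝ, E))
          (g := ψ) (f := ψ.symm) p
          (ψ.contMDiff.mdifferentiableAt (by simp)) (ψ.symm.contMDiff.mdifferentiableAt (by simp))
        have e : ψ ∘ ψ.symm = id := funext ψ.apply_symm_apply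
        rw [← h, e, tangentMap_id, id]
      contMDiff_toFun := ψ.contMDiff.contMDiff_tangentMap (by simp)
      contMDiff_invFun := ψ.symm.contMDiff.contMDiff_tangentMap (by simp) }
  total_mk y v := by rfl

@[simp] lemma tangentAut_fiber (ψ : N ≃ₘ⟮𝓘(ℝ, E), 𝓘(ℝ, E)⟯ N) (y : N)
    (u : TangentSpace 𝓘(ℝ, E) y) :
    (tangentAut ψ).fiber y u = mfderiv 𝓘(ℝ, E) 𝓘(ℝ, E) ψ y u := rfl

/-- `VectorField.mpullback` is expressed through the total function `inverse`; for a diffeomorphism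
the differential is invertible, so this is the genuine inverse. -/
lemma inverse_mfderiv_apply (ψ : N ≃ₘ⟮𝓘(ℝ, E), 𝓘(ℝ, E)⟯ N) (y : N)
    (v : TangentSpace 𝓘(ℝ, E) (ψ y)) :
    (mfderiv 𝓘(ℝ, E) 𝓘(ℝ, E) ψ y).inverse v = ((tangentAut ψ).fiber y).symm v :=
  congr($(ContinuousLinearMap.inverse_equiv ((tangentAut ψ).fiber y)) v)

namespace PseudoRiemannianMetric

/-- `ψ` is an isometry of `h`. -/
def IsIsometry (h : PseudoRiemannianMetric E N) (ψ : N ≃ₘ⟮𝓘(ℝ, E), 𝓘(ℝ, E)⟯ N) : Prop :=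
  ∀ (y : N) (u v : TangentSpace 𝓘(ℝ, E) y),
    h.val (ψ y) (mfderiv 𝓘(ℝ, E) 𝓘(ℝ, E) ψ y u) (mfderiv 𝓘(ℝ, E) 𝓘(ℝ, E) ψ y v) = h.val y u v

variable {h : PseudoRiemannianMetric E N} {ψ : N ≃ₘ⟮𝓘(ℝ, E), 𝓘(ℝ, E)⟯ N}
  {X Y Z X' Y' Z' : Π y : N, TangentSpace 𝓘(ℝ, E) y} {y : N}

/-- The isometry property says `h(Y', Z') ∘ ψ = h(Y, Z)`; the rest is the chain rule. -/
lemma IsIsometry.mvfderiv_pair (hψ : h.IsIsometry ψ)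
    (hY : ∀ y, Y' (ψ y) = (tangentAut ψ).fiber y (Y y))
    (hZ : ∀ y, Z' (ψ y) = (tangentAut ψ).fiber y (Z y))
    (hdY : MDiffAt (T% Y) y) (hdZ : MDiffAt (T% Z) y) (u : TangentSpace 𝓘(ℝ, E) y) :
    (d% (h.pair Y' Z')) (ψ y) (mfderiv 𝓘(ℝ, E) 𝓘(ℝ, E) ψ y u) = (d% (h.pair Y Z)) y u := by
  have e : h.pair Y' Z' ∘ ψ = h.pair Y Z := funext fun z ↦ by
    simp only [pair, Function.comp, hY, hZ, tangentAut_fiber, hψ z]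
  have hp : MDiffAt (h.pair Y' Z') (ψ y) := mdifferentiableAt_pair
    (UnbasedAut.mdifferentiableAt_image (f := tangentAut ψ) hY hdY)
    (UnbasedAut.mdifferentiableAt_image (f := tangentAut ψ) hZ hdZ)
  rw [← e]
  exact congr($(mfderiv_comp y hp (ψ.contMDiff.mdifferentiableAt (by simp))) u).symm

variable [FiniteDimensional ℝ E]

lemma mlieBracket_image
    (hX : ∀ y, X' (ψ y) = (tangentAut ψ).fiber y (X y))
    (hY : ∀ y, Y' (ψ y) = (tangentAut ψ).fiber y (Y y))
    (hdX : MDiffAt (T% X) y) (hdY : MDiffAt (T% Y) y) :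
    VectorField.mlieBracket 𝓘(ℝ, E) X' Y' (ψ y) =
      mfderiv 𝓘(ℝ, E) 𝓘(ℝ, E) ψ y (VectorField.mlieBracket 𝓘(ℝ, E) X Y y) := by
  -- Being `ψ`-related means that the first field is the pullback of the second, so the claim
  -- reduces to compatibility of pullback with the bracket.
  have pull {Z Z' : Π y : N, TangentSpace 𝓘(ℝ, E) y}
      (hZ : ∀ y, Z' (ψ y) = (tangentAut ψ).fiber y (Z y)) :
      VectorField.mpullback 𝓘(ℝ, E) 𝓘(ℝ, E) ψ Z' = Z := funext fun z ↦ by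
    rw [VectorField.mpullback_apply, hZ]
    exact (inverse_mfderiv_apply ψ z _).trans (((tangentAut ψ).fiber z).symm_apply_apply _)
  -- Compatibility of brackets with pullback asks for smoothness `minSmoothness ℝ 2`, which over `ℝ`
  -- is just `2`.
  have h2 : minSmoothness ℝ 2 ≤ ∞ := by
    rw [minSmoothness_of_isRCLikeNormedField]
    exact WithTop.coe_le_coe.2 (le_top : (2 : ℕ∞) ≤ ⊤)
  have : IsManifold 𝓘(ℝ, E) (minSmoothness ℝ 2) N := IsManifold.of_le h2
  have key := VectorField.mpullback_mlieBracket (f := ψ) (x₀ := y) (n := ∞)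
    (UnbasedAut.mdifferentiableAt_image (f := tangentAut ψ) hX hdX)
    (UnbasedAut.mdifferentiableAt_image (f := tangentAut ψ) hY hdY)
    ψ.contMDiff.contMDiffAt h2
  rw [pull hX, pull hY] at key
  rw [← key, VectorField.mpullback_apply]
  exact (((tangentAut ψ).fiber y).apply_symm_apply _).symm.trans
    congr((tangentAut ψ).fiber y $(inverse_mfderiv_apply ψ y _)).symm

/-- All six terms are invariant separately: the derivatives of scalar products by
`IsIsometry.mvfderiv_pair`, the bracket terms by `mlieBracket_image`. -/
lemma IsIsometry.koszul_image (hψ : h.IsIsometry ψ)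
    (hX : ∀ y, X' (ψ y) = (tangentAut ψ).fiber y (X y))
    (hY : ∀ y, Y' (ψ y) = (tangentAut ψ).fiber y (Y y))
    (hZ : ∀ y, Z' (ψ y) = (tangentAut ψ).fiber y (Z y))
    (hdX : MDiffAt (T% X) y) (hdY : MDiffAt (T% Y) y) (hdZ : MDiffAt (T% Z) y) :
    h.koszul X' Y' Z' (ψ y) = h.koszul X Y Z y := by
  simp only [koszul, mlieBracket_image hX hY hdX hdY, mlieBracket_image hX hZ hdX hdZ,
    mlieBracket_image hY hZ hdY hdZ, hX, hY, hZ, tangentAut_fiber, hψ y,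
    hψ.mvfderiv_pair hX hY hdX hdY, hψ.mvfderiv_pair hX hZ hdX hdZ, hψ.mvfderiv_pair hY hZ hdY hdZ]

/-- Isometries preserve the Levi-Civita connection. -/
lemma IsIsometry.leviCivita_image (hψ : h.IsIsometry ψ)
    (hY : ∀ y, Y' (ψ y) = (tangentAut ψ).fiber y (Y y)) (hdY : MDiffAt (T% Y) y)
    (u : TangentSpace 𝓘(ℝ, E) y) :
    h.leviCivita Y' (ψ y) (mfderiv 𝓘(ℝ, E) 𝓘(ℝ, E) ψ y u) =
      mfderiv 𝓘(ℝ, E) 𝓘(ℝ, E) ψ y (h.leviCivita Y y u) := by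
  -- By nondegeneracy it suffices to pair with vectors `w' = dψ w`. Extending `u` and `w` to fields
  -- and taking their images makes the invariant Koszul expression available on both sides.
  refine sub_eq_zero.1 (h.nondegenerate (ψ y) _ fun w' ↦ ?_)
  obtain ⟨w, rfl⟩ := ((tangentAut ψ).fiber y).surjective w'
  have hu := mdifferentiableAt_extend 𝓘(ℝ, E) E (x := y) u
  have hw := mdifferentiableAt_extend 𝓘(ℝ, E) E (x := y) w
  obtain ⟨X', hX⟩ := (tangentAut ψ).exists_image (extend E u)
  obtain ⟨Z', hZ⟩ := (tangentAut ψ).exists_image (extend E w)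
  have e1 := val_leviCivitaAux (h := h) hu hdY hw
  have e2 := val_leviCivitaAux (h := h)
    (UnbasedAut.mdifferentiableAt_image (f := tangentAut ψ) hX hu)
    (UnbasedAut.mdifferentiableAt_image (f := tangentAut ψ) hY hdY)
    (UnbasedAut.mdifferentiableAt_image (f := tangentAut ψ) hZ hw)
  have e3 := hψ.koszul_image hX hY hZ hu hdY hw
  change 2 * h.val (ψ y) (h.leviCivita Y' (ψ y) (X' (ψ y))) (Z' (ψ y)) = h.koszul X' Y' Z' (ψ y)
    at e2
  rw [show X' (ψ y) = _ from hX y, show Z' (ψ y) = _ from hZ y, e3, ← e1, extend_apply_self,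
    extend_apply_self, tangentAut_fiber, tangentAut_fiber] at e2
  rw [tangentAut_fiber, map_sub, sub_apply, hψ y]
  change _ - h.val y (h.leviCivitaAux Y y u) w = 0
  linarith

/-- Isometries preserve the musical isomorphism. -/
lemma IsIsometry.sharp_image (hψ : h.IsIsometry ψ)
    {α : Dual ℝ (TangentSpace 𝓘(ℝ, E) y)} {α' : Dual ℝ (TangentSpace 𝓘(ℝ, E) (ψ y))}
    (hα : ∀ u, α' (mfderiv 𝓘(ℝ, E) 𝓘(ℝ, E) ψ y u) = α u) :
    h.sharp (ψ y) α' = mfderiv 𝓘(ℝ, E) 𝓘(ℝ, E) ψ y (h.sharp y α) := by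
  refine sub_eq_zero.1 (h.nondegenerate (ψ y) _ fun w' ↦ ?_)
  obtain ⟨w, rfl⟩ := ((tangentAut ψ).fiber y).surjective w'
  rw [tangentAut_fiber, map_sub, sub_apply, hψ y, val_sharp, val_sharp, hα, sub_self]

end PseudoRiemannianMetric
end Isometries

/-! ### Bundle-valued two-forms: Hodge operator and pairings -/

section TwoForms

variable {M : Type*} [TopologicalSpace M] [ChartedSpace (EuclideanSpace ℝ (Fin 4)) M]
  [IsManifold (𝓡 4) ∞ M]
  {W W' : Type*} [AddCommGroup W] [Module ℝ W] [AddCommGroup W'] [Module ℝ W']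

namespace LorentzianMetric

variable (g : LorentzianMetric M) (o : ManifoldOrientation M)

/-- The Hodge operator acts on the form part only: its values are linear combinations of values of
`η`, with coefficients taken from the volume form. -/
lemma hodge_compAlternatingMap (x : M) (A : W →ₗ[ℝ] W')
    (η : TangentSpace (𝓡 4) x [⋀^Fin 2]→ₗ[ℝ] W) :
    g.hodge o x (A.compAlternatingMap η) = A.compAlternatingMap (g.hodge o x η) := by
  change _ = LinearMap.compAlternatingMapₗ (S := ℝ) A (g.hodge o x η)
  simp only [hodge, map_smul, map_sum]
  refine congr_arg _ (Finset.sum_congr rfl fun i _ ↦ Finset.sum_congr rfl fun j _ ↦ ?_)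
  ext v
  simp

lemma twoFormInner_compAlternatingMap (x : M) {Q : W →ₗ[ℝ] W →ₗ[ℝ] ℝ} {Q' : W' →ₗ[ℝ] W' →ₗ[ℝ] ℝ}
    {A : W →ₗ[ℝ] W'} (hA : ∀ s t, Q' (A s) (A t) = Q s t)
    (ρ η : TangentSpace (𝓡 4) x [⋀^Fin 2]→ₗ[ℝ] W) :
    g.twoFormInner x Q' (A.compAlternatingMap ρ) (A.compAlternatingMap η) =
      g.twoFormInner x Q ρ η := by
  simp [twoFormInner, hA]

/-- The linear form `u ↦ (ρ, Θ(u) η)`. -/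
def formPairing {T : Type*} [AddCommGroup T] [Module ℝ T] (x : M) (Q : W →ₗ[ℝ] W →ₗ[ℝ] ℝ)
    (ρ η : TangentSpace (𝓡 4) x [⋀^Fin 2]→ₗ[ℝ] W) : (T →ₗ[ℝ] W →ₗ[ℝ] W) →ₗ[ℝ] Dual ℝ T :=
  LinearMap.compRight ℝ
    (g.twoFormInner x Q ρ ∘ₗ
      { toFun := fun A : W →ₗ[ℝ] W ↦ A.compAlternatingMap η
        map_add' := fun _ _ ↦ rfl
        map_smul' := fun _ _ ↦ rfl })

lemma formPairing_apply {T : Type*} [AddCommGroup T] [Module ℝ T] (x : M) (Q : W →ₗ[ℝ] W →ₗ[ℝ] ℝ)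
    (ρ η : TangentSpace (𝓡 4) x [⋀^Fin 2]→ₗ[ℝ] W) (Θ : T →ₗ[ℝ] W →ₗ[ℝ] W) (u : T) :
    g.formPairing x Q ρ η Θ u = g.twoFormInner x Q ρ ((Θ u).compAlternatingMap η) := rfl

/-- The pairing with `(♯ ⊗ id) Θ` is the metric dual of `u ↦ (ρ, Θ(u) η)`. -/
lemma tensorPairing_map_dual {T : Type*} [AddCommGroup T] [Module ℝ T] [Module.Finite ℝ T]
    (x : M) (Q : W →ₗ[ℝ] W →ₗ[ℝ] ℝ)
    (ρ η : TangentSpace (𝓡 4) x [⋀^Fin 2]→ₗ[ℝ] W) (sh : Dual ℝ T →ₗ[ℝ] T)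
    (Θ : T →ₗ[ℝ] W →ₗ[ℝ] W) :
    g.tensorPairing x Q ρ η
      (TensorProduct.map sh LinearMap.id ((dualTensorHomEquiv ℝ T (W →ₗ[ℝ] W)).symm Θ)) =
      sh (g.formPairing x Q ρ η Θ) := by
  -- Both sides are additive in the tensor representing `Θ`, so pure tensors suffice; on `β ⊗ B`
  -- both equal `(ρ, B η) • sh β`.
  obtain ⟨t, rfl⟩ := (dualTensorHomEquiv ℝ T (W →ₗ[ℝ] W)).surjective Θ
  rw [LinearEquiv.symm_apply_apply]
  induction t using TensorProduct.induction_on with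
  | zero => simp [tensorPairing]
  | tmul β B =>
    have : g.formPairing x Q ρ η (dualTensorHomEquiv ℝ T (W →ₗ[ℝ] W) (β ⊗ₜ[ℝ] B)) =
        g.twoFormInner x Q ρ (B.compAlternatingMap η) • β := by
      ext u
      simp [formPairing_apply, mul_comm (β u)]
    rw [this, map_smul]
    simp [tensorPairing]
    rfl
  | add t₁ t₂ h₁ h₂ =>
    rw [map_add, map_add, map_add, map_add, ← h₁, ← h₂]
    simp [tensorPairing]

end LorentzianMetric
end TwoForms

/-! ### Naturality of the tension field, the gradient, `Q` and `Θ` -/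

section Naturality

variable {E : Type*} [NormedAddCommGroup E] [NormedSpace ℝ E] [FiniteDimensional ℝ E]
  {N : Type*} [TopologicalSpace N] [ChartedSpace E N] [IsManifold 𝓘(ℝ, E) ∞ N]
  {M : Type*} [TopologicalSpace M] [ChartedSpace (EuclideanSpace ℝ (Fin 4)) M]
  [IsManifold (𝓡 4) ∞ M]

/-- The second fundamental form of `ψ ∘ φ`, for an isometry `ψ`. -/
lemma secondFundamentalForm_comp (g : LorentzianMetric M) {G : PseudoRiemannianMetric E N}
    {ψ : N ≃ₘ⟮𝓘(ℝ, E), 𝓘(ℝ, E)⟯ N} (hψ : G.IsIsometry ψ) {φ : M → N}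
    (hφ : ContMDiff (𝓡 4) 𝓘(ℝ, E) ∞ φ) (x : M) (u v : TangentSpace (𝓡 4) x) :
    secondFundamentalForm g G (ψ ∘ φ) x u v =
      mfderiv 𝓘(ℝ, E) 𝓘(ℝ, E) ψ (φ x) (secondFundamentalForm g G φ x u v) := by
  have hcomp (x' : M) (w : TangentSpace (𝓡 4) x') : mfderiv (𝓡 4) 𝓘(ℝ, E) (ψ ∘ φ) x' w =
      mfderiv 𝓘(ℝ, E) 𝓘(ℝ, E) ψ (φ x') (mfderiv (𝓡 4) 𝓘(ℝ, E) φ x' w) :=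
    congr($(mfderiv_comp x' (ψ.contMDiff.mdifferentiableAt (by simp))
      (hφ.mdifferentiableAt (by simp))) w)
  have hs : MDifferentiableAt (𝓡 4) (𝓘(ℝ, E).prod 𝓘(ℝ, E))
      (fun x' ↦ TotalSpace.mk' E (E := (TangentSpace 𝓘(ℝ, E) : N → Type _)) (φ x')
        (mfderiv (𝓡 4) 𝓘(ℝ, E) φ x' (extend (EuclideanSpace ℝ (Fin 4)) v x'))) x :=
    -- The field `dφ Y` along `φ` is the tangent map of `φ` composed with the field `Y`, hence
    -- differentiable as a map into the tangent bundle.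
    ((hφ.contMDiff_tangentMap (m := ∞) (by simp)).mdifferentiableAt (by simp)).comp x
      (mdifferentiableAt_extend (𝓡 4) (EuclideanSpace ℝ (Fin 4)) v)
  -- By the chain rule `dψ` takes `dφ Y` to `d(ψ ∘ φ) Y`, so the general lemma handles the
  -- connection term; the term `dφ (∇_u Y)` needs only the chain rule.
  have key := (tangentAut ψ).pullbackConnection_image G.leviCivita
    (fun _ _ hτ _ hσ u ↦ hψ.leviCivita_image hτ hσ u) hs u
  simp only [secondFundamentalForm, hcomp]
  rw [map_sub]
  exact congr_arg (fun w : TangentSpace 𝓘(ℝ, E) (ψ (φ x)) ↦ w - _) key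

lemma tensionField_comp (g : LorentzianMetric M) {G : PseudoRiemannianMetric E N}
    {ψ : N ≃ₘ⟮𝓘(ℝ, E), 𝓘(ℝ, E)⟯ N} (hψ : G.IsIsometry ψ) {φ : M → N}
    (hφ : ContMDiff (𝓡 4) 𝓘(ℝ, E) ∞ φ) (x : M) :
    tensionField g G (ψ ∘ φ) x = mfderiv 𝓘(ℝ, E) 𝓘(ℝ, E) ψ (φ x) (tensionField g G φ x) := by
  simp only [tensionField, LorentzianMetric.trace, map_sum, secondFundamentalForm_comp g hψ hφ]

/-- Differentiating `Φ ∘ ψ = Φ` shows that `dΦ` is invariant, and isometries commute with `♯`. -/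
lemma ScalarStructure.IsAut.grad_image {𝒮 : ScalarStructure E N}
    {ψ : N ≃ₘ⟮𝓘(ℝ, E), 𝓘(ℝ, E)⟯ N} (hψ : 𝒮.IsAut ψ) (y : N) :
    𝒮.grad (ψ y) = mfderiv 𝓘(ℝ, E) 𝓘(ℝ, E) ψ y (𝒮.grad y) := by
  refine PseudoRiemannianMetric.IsIsometry.sharp_image (h := 𝒮.metric) hψ.1 fun u ↦ ?_
  have e : 𝒮.Φ ∘ ψ = 𝒮.Φ := funext hψ.2
  conv_rhs => rw [← e]
  exact congr($(mfderiv_comp y (𝒮.contMDiff_Φ.mdifferentiableAt (by simp))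
    (ψ.contMDiff.mdifferentiableAt (by simp))) u).symm

lemma ScalarStructure.IsAut.modifiedTensionField_comp (g : LorentzianMetric M)
    {𝒮 : ScalarStructure E N} {ψ : N ≃ₘ⟮𝓘(ℝ, E), 𝓘(ℝ, E)⟯ N} (hψ : 𝒮.IsAut ψ) {φ : M → N}
    (hφ : ContMDiff (𝓡 4) 𝓘(ℝ, E) ∞ φ) (x : M) :
    modifiedTensionField g 𝒮 (ψ ∘ φ) x =
      mfderiv 𝓘(ℝ, E) 𝓘(ℝ, E) ψ (φ x) (modifiedTensionField g 𝒮 φ x) := by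
  have h : 𝒮.metric.IsIsometry ψ := hψ.1
  rw [modifiedTensionField, modifiedTensionField, map_sub, tensionField_comp g h hφ]
  congr 1
  exact hψ.grad_image (φ x)

variable {F : Type*} [NormedAddCommGroup F] [NormedSpace ℝ F] [FiniteDimensional ℝ F]
  {S : N → Type*} [TopologicalSpace (TotalSpace F S)]
  [∀ y, AddCommGroup (S y)] [∀ y, Module ℝ (S y)] [∀ y, TopologicalSpace (S y)]
  [∀ y, IsTopologicalAddGroup (S y)] [∀ y, ContinuousSMul ℝ (S y)]
  [FiberBundle F S] [VectorBundle ℝ F S] [ContMDiffVectorBundle ∞ F S 𝓘(ℝ, E)]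
  {f : UnbasedAut E F S}

/-- `Q` is built from `ω` and `J` alone, and `f` respects both. -/
lemma UnbasedAut.IsSymplectic.Q_image {Ξ : ElectromagneticStructure E F S}
    (hf : f.IsSymplectic Ξ.toDualityStructure)
    (hJ : ∀ (y : N) (s : S y), f.fiber y (Ξ.J y s) = Ξ.J (f.base y) (f.fiber y s))
    (y : N) (s t : S y) : Ξ.Q (f.base y) (f.fiber y s) (f.fiber y t) = Ξ.Q y s t := by
  rw [ElectromagneticStructure.Q_apply, ElectromagneticStructure.Q_apply, ← hJ, hf]

/-- `Θ` is the commutator of `D` and `J`, and `f` commutes with each of them. -/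
lemma UnbasedAut.IsCovariantlyConstant.fundamentalForm_image {Ξ : ElectromagneticStructure E F S}
    (hf : f.IsCovariantlyConstant Ξ.toDualityStructure)
    (hJ : ∀ (y : N) (s : S y), f.fiber y (Ξ.J y s) = Ξ.J (f.base y) (f.fiber y s))
    (y : N) (u : TangentSpace 𝓘(ℝ, E) y) (s : S y) :
    Ξ.fundamentalForm (f.base y) (mfderiv 𝓘(ℝ, E) 𝓘(ℝ, E) f.base y u) (f.fiber y s) =
      f.fiber y (Ξ.fundamentalForm y u s) := by
  have hs : MDiffAt (T% (extend F s)) y := mdifferentiableAt_extend 𝓘(ℝ, E) F s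
  obtain ⟨τ, hτ⟩ := f.exists_image (extend F s)
  have e1 := Ξ.fundamentalForm_apply hs u
  have e2 := Ξ.fundamentalForm_apply (UnbasedAut.mdifferentiableAt_image hτ hs)
    (mfderiv 𝓘(ℝ, E) 𝓘(ℝ, E) f.base y u)
  -- Since `J τ` is the image of `J σ` whenever `τ` is the image of `σ`, covariant constancy applies
  -- to both terms of the commutator.
  have hJτ (z : N) : (fun z ↦ Ξ.J z (τ z)) (f.base z) = f.fiber z (Ξ.J z (extend F s z)) := by
    simp only [hτ, hJ]
  rw [hτ, extend_apply_self, hf _ _ hτ y hs,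
    hf (fun z ↦ Ξ.J z (extend F s z)) _ hJτ y (Ξ.mdifferentiableAt_J hs)] at e2
  rw [extend_apply_self] at e1
  rw [e2, e1, map_sub, hJ]

end Naturality

/-! ### Transport of configurations and solutions -/

section Symmetries

variable {E : Type*} [NormedAddCommGroup E] [NormedSpace ℝ E] [FiniteDimensional ℝ E]
  {N : Type*} [TopologicalSpace N] [ChartedSpace E N] [IsManifold 𝓘(ℝ, E) ∞ N]
  {F : Type*} [NormedAddCommGroup F] [NormedSpace ℝ F] [FiniteDimensional ℝ F]
  {S : N → Type*} [TopologicalSpace (TotalSpace F S)]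
  [∀ y, AddCommGroup (S y)] [∀ y, Module ℝ (S y)] [∀ y, TopologicalSpace (S y)]
  [∀ y, IsTopologicalAddGroup (S y)] [∀ y, ContinuousSMul ℝ (S y)]
  [FiberBundle F S] [VectorBundle ℝ F S] [ContMDiffVectorBundle ∞ F S 𝓘(ℝ, E)]
  {M : Type*} [TopologicalSpace M] [ChartedSpace (EuclideanSpace ℝ (Fin 4)) M]
  [IsManifold (𝓡 4) ∞ M]
  {f : UnbasedAut E F S} {c : FieldPair E F S M}
  {o : ManifoldOrientation M} {g : LorentzianMetric M}
  {𝒟 : ScalarElectromagneticStructure E F S}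

/-- The fiber map of `f` can be moved outward past `J` and then past the Hodge operator, leaving the
polarization condition of `c`. -/
lemma smul_mem_Conf (hJ : ∀ (y : N) (s : S y),
      f.fiber y (𝒟.em.J y s) = 𝒟.em.J (f.base y) (f.fiber y s))
    (hc : c ∈ 𝒟.Conf o g) : f • c ∈ 𝒟.Conf o g := by
  intro x
  let A : S (c.φ x) →ₗ[ℝ] S (f.base (c.φ x)) := (f.fiber (c.φ x)).toLinearEquiv.toLinearMap
  have e : (𝒟.em.J (f.base (c.φ x))).toLinearMap.compAlternatingMap (A.compAlternatingMap (c.V x)) =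
      A.compAlternatingMap ((𝒟.em.J (c.φ x)).toLinearMap.compAlternatingMap (c.V x)) := by
    ext v
    exact (hJ (c.φ x) (c.V x v)).symm
  refine (congr_arg (g.hodge o x) e).trans ?_
  rw [g.hodge_compAlternatingMap]
  exact congr_arg _ (hc x)

/-- The twisted differential of the image two-form is the image of the twisted differential: the
three derivative terms use `UnbasedAut.pullbackConnection_image`, and the bracket terms live on `M`
and are only composed with a linear map. -/
lemma FieldPair.SolvesElectromagnetic.smul {Δ : DualityStructure E F S}
    (hf : f.IsCovariantlyConstant Δ) (hc : c.SolvesElectromagnetic Δ) :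
    (f • c).SolvesElectromagnetic Δ := by
  intro X Y Z hX hY hZ x
  have key {X Y : Π x : M, TangentSpace (𝓡 4) x} (hX : IsSmoothVectorField X)
      (hY : IsSmoothVectorField Y) (u : TangentSpace (𝓡 4) x) :
      pullbackConnection F Δ.D (f • c).φ (fun x' ↦ (f • c).V x' ![X x', Y x']) x u =
        f.fiber (c.φ x) (pullbackConnection F Δ.D c.φ (fun x' ↦ c.V x' ![X x', Y x']) x u) :=
    f.pullbackConnection_image Δ.D hf ((c.contMDiff_V X Y hX hY).mdifferentiableAt (by simp)) u
  have e : twistedExtDeriv F Δ.D (f • c).φ (f • c).V X Y Z x =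
      f.fiber (c.φ x) (twistedExtDeriv F Δ.D c.φ c.V X Y Z x) := by
    simp only [twistedExtDeriv, map_sub, map_add]
    rw [key hX hY, key hX hZ, key hY hZ]
    rfl
  rw [e, hc X Y Z hX hY hZ x]
  exact map_zero (f.fiber (c.φ x))

lemma FieldPair.SolvesScalar.smul (hsymp : f.IsSymplectic 𝒟.em.toDualityStructure)
    (hf : f.IsCovariantlyConstant 𝒟.em.toDualityStructure) (hiso : 𝒟.scalar.IsAut f.base)
    (hJ : ∀ (y : N) (s : S y), f.fiber y (𝒟.em.J y s) = 𝒟.em.J (f.base y) (f.fiber y s))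
    (hc : c.SolvesScalar o g 𝒟) : (f • c).SolvesScalar o g 𝒟 := by
  intro x
  let A : S (c.φ x) →ₗ[ℝ] S (f.base (c.φ x)) := (f.fiber (c.φ x)).toLinearEquiv.toLinearMap
  let α := g.formPairing x (𝒟.em.Q (c.φ x)) (g.hodge o x (c.V x)) (c.V x)
    (𝒟.em.fundamentalForm (c.φ x))
  let α' := g.formPairing x (𝒟.em.Q (f.base (c.φ x))) (g.hodge o x (A.compAlternatingMap (c.V x)))
    (A.compAlternatingMap (c.V x)) (𝒟.em.fundamentalForm (f.base (c.φ x)))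
  -- The source one-form of `f • c` pulls back under `df₀` to that of `c`: `f` is moved outside `Θ`
  -- and `∗`, then dropped as an isometry of `Q`.
  have hα (u : TangentSpace 𝓘(ℝ, E) (c.φ x)) :
      α' (mfderiv 𝓘(ℝ, E) 𝓘(ℝ, E) f.base (c.φ x) u) = α u := by
    have e : (𝒟.em.fundamentalForm (f.base (c.φ x))
        (mfderiv 𝓘(ℝ, E) 𝓘(ℝ, E) f.base (c.φ x) u)).compAlternatingMap
          (A.compAlternatingMap (c.V x)) =
        A.compAlternatingMap ((𝒟.em.fundamentalForm (c.φ x) u).compAlternatingMap (c.V x)) := by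
      ext v
      exact hf.fundamentalForm_image hJ (c.φ x) u (c.V x v)
    simp only [α, α', LorentzianMetric.formPairing_apply]
    rw [e, g.hodge_compAlternatingMap]
    exact g.twoFormInner_compAlternatingMap x (hsymp.Q_image hJ (c.φ x)) _ _
  have h1 : g.tensorPairing x (𝒟.em.Q (c.φ x)) (g.hodge o x (c.V x)) (c.V x)
      (𝒟.fundamentalField (c.φ x)) = 𝒟.scalar.metric.sharp (c.φ x) α :=
    g.tensorPairing_map_dual x _ _ _ _ _
  have h2 : g.tensorPairing x (𝒟.em.Q (f.base (c.φ x))) (g.hodge o x (A.compAlternatingMap (c.V x)))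
      (A.compAlternatingMap (c.V x)) (𝒟.fundamentalField (f.base (c.φ x))) =
        𝒟.scalar.metric.sharp (f.base (c.φ x)) α' :=
    g.tensorPairing_map_dual x _ _ _ _ _
  have h3 := PseudoRiemannianMetric.IsIsometry.sharp_image (h := 𝒟.scalar.metric) hiso.1 hα
  have h4 := hiso.modifiedTensionField_comp g c.contMDiff_φ x
  -- The fibers at `(f.base ∘ c.φ) x` and at `f.base (c.φ x)` agree only by unfolding; the
  -- ascription puts all terms in one tangent space.
  let θ : TangentSpace 𝓘(ℝ, E) (f.base (c.φ x)) :=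
    modifiedTensionField g 𝒟.scalar (f.base ∘ c.φ) x
  suffices θ - (1 / 2 : ℝ) • 𝒟.scalar.metric.sharp (f.base (c.φ x)) α' = 0 by
    rw [← h2] at this
    exact this
  have hx := hc x
  rw [h1] at hx
  rw [show θ = _ from h4, h3, ← map_smul, ← map_sub, hx, map_zero]

lemma smul_mem_Sol (hf : f ∈ 𝒟.symmetryGroup) (hc : c ∈ 𝒟.Sol o g) : f • c ∈ 𝒟.Sol o g := by
  obtain ⟨⟨⟨hsymp, hcc⟩, hiso⟩, hAd⟩ := hf
  have hJ := (UnbasedAut.Ad_eq_iff _ _ _).1 hAd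
  exact ⟨smul_mem_Conf hJ hc.1, hc.2.1.smul hsymp hcc hiso hJ, hc.2.2.smul hcc⟩

end Symmetries

end ESM

end

theorem mainTheorem2
    -- the scalar manifold `N`
    {E : Type*} [NormedAddCommGroup E] [NormedSpace ℝ E] [FiniteDimensional ℝ E]
    {N : Type*} [TopologicalSpace N] [T2Space N] [SecondCountableTopology N] [ConnectedSpace N]
    [ChartedSpace E N] [IsManifold 𝓘(ℝ, E) ∞ N]
    -- the vector bundle `S` on `N`
    {F : Type*} [NormedAddCommGroup F] [NormedSpace ℝ F] [FiniteDimensional ℝ F]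
    {S : N → Type*} [TopologicalSpace (TotalSpace F S)]
    [∀ y, AddCommGroup (S y)] [∀ y, Module ℝ (S y)] [∀ y, TopologicalSpace (S y)]
    [∀ y, IsTopologicalAddGroup (S y)] [∀ y, ContinuousSMul ℝ (S y)]
    [FiberBundle F S] [VectorBundle ℝ F S] [ContMDiffVectorBundle ∞ F S 𝓘(ℝ, E)]
    -- the oriented four-manifold `M`
    {M : Type*} [TopologicalSpace M] [T2Space M] [SecondCountableTopology M] [ConnectedSpace M]
    [ChartedSpace (EuclideanSpace ℝ (Fin 4)) M] [IsManifold (𝓡 4) ∞ M]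
    (o : ESM.ManifoldOrientation M)
    -- the scalar-electromagnetic structure, the Lorentzian metric and the symmetry
    (𝒟 : ESM.ScalarElectromagneticStructure E F S) (g : ESM.LorentzianMetric M)
    (f : ESM.UnbasedAut E F S) (hf : f ∈ 𝒟.symmetryGroup) :
    (fun c : ESM.FieldPair E F S M ↦ f • c) '' 𝒟.Sol o g = 𝒟.Sol o g ∧
    ∀ c ∈ 𝒟.Conf o g, f • c ∈ 𝒟.Conf o g ∧ (f • c ∈ 𝒟.Sol o g ↔ c ∈ 𝒟.Sol o g) := by

  have hsol {c : ESM.FieldPair E F S M} : f • c ∈ 𝒟.Sol o g ↔ c ∈ 𝒟.Sol o g := by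
    refine ⟨fun h ↦ ?_, ESM.smul_mem_Sol hf⟩
    -- The converse is the forward implication for `f⁻¹`, again a symmetry, applied to `f • c`.
    rw [← inv_smul_smul f c]
    exact ESM.smul_mem_Sol (inv_mem hf) h
  refine ⟨?_, fun c hc ↦ ⟨ESM.smul_mem_Conf ((ESM.UnbasedAut.Ad_eq_iff _ _ _).1 hf.2) hc, hsol⟩⟩
  ext c
  constructor
  · rintro ⟨c, hc, rfl⟩
    exact hsol.2 hc
  · intro hc
    exact ⟨f⁻¹ • c, ESM.smul_mem_Sol (inv_mem hf) hc, smul_inv_smul f c⟩
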